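/- All systems are finite-dimensional, and $d\ge 1$. A \emph{quantum process} is a completely positive trace-preserving linear map. A \emph{universal quantum masker} for a $d$-dimensional system $C$ is a quantum process $\Phi$ from $C$ to a bipartite system $AB$ such that neither of the marginals $\operatorname{Tr}_B\Phi(\rho)$ and $\operatorname{Tr}_A\Phi(\rho)$ depends on the state $\rho$ of $C$, and such that some quantum process $\mathcal U$ from $AB$ to $C$ satisfies $\mathcal U(\Phi(\rho))=\rho$ for all states $\rho$. A \emph{safe state} of $\Phi$ is a state $\omega_S$ of an ancillary system $S$ for which there is an isometry $M\colon C\otimes S\to A\otimes B$ (a unitary, if the dimensions agree) with $\Phi(\rho)=M(\rho\otimes\omega_S)M^\dagger$ for all states $\rho$ of $C$. Write $S(\omega)=-\operatorname{Tr}\,\omega\log_2\omega$ for the von Neumann entropy. A state of $AB$ is \emph{separable} if it is a finite convex combination of product states $\sigma\otimes\tau$; it is \emph{quantum-classical} if it equals $\sum_j p_j\,\sigma_j\otimes|e_j\rangle\langle e_j|$ for some orthonormal basis $(e_j)$ of $B$, some states $\sigma_j$ of $A$ and some probability distribution $(p_j)$; it is \emph{classically correlated} if it equals $\sum_{i,j}p_{ij}\,|f_i\rangle\langle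 f_i|\otimes|e_j\rangle\langle e_j|$ for some orthonormal bases $(f_i)$ of $A$ and $(e_j)$ of $B$ and some joint probability distribution $(p_{ij})$. The bases may depend on the state. \textbf{Theorem.} Let $\omega_S$ be a safe state of a universal quantum masker $\Phi$ for a $d$-dimensional system. (i) $S(\omega_S)\ge\log_2 d$. (ii) If $d\ge 2$ and $\Phi(\rho)$ is separable for every state $\rho$, then $S(\omega_S)>\log_2 d$. (iii) If $\Phi(\rho)$ is quantum-classical for every state $\rho$, then $S(\omega_S)\ge 2\log_2 d$. (iv) If $d\ge 2$, there is no universal quantum masker $\Phi$ for a $d$-dimensional system such that $\Phi(\rho)$ is classically correlated for every state $\rho$. Moreover (no-masking theorem, a corollary of (i)), if $d\ge 2$, there is no isometry $V\colon C\to A\otimes B$ such that both marginals of $V|\psi\rangle\langle\psi|V^\dagger$ are independent of the pure state $|\psi\rangle$ of $C$. -/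

import Mathlib

open scoped Kronecker Matrix ComplexOrder

namespace Masking

/-- A quantum state (density matrix): positive semidefinite with unit trace. -/
structure IsState {n : Type*} [Fintype n] (ρ : Matrix n n ℂ) : Prop where
  posSemidef : ρ.PosSemidef
  trace_eq_one : ρ.trace = 1

/-- The operator `|v⟩⟨v|`. -/
def ketbra {n : Type*} (v : EuclideanSpace ℂ n) : Matrix n n ℂ :=
  Matrix.of fun i j => v i * star (v j)

/-- The pure states of a finite-dimensional system. -/
def pureStates (n : Type*) [Fintype n] : Set (Matrix n n ℂ) :=
  {ρ | ∃ ψ : EuclideanSpace ℂ n, ‖ψ‖ = 1 ∧ ρ = ketbra ψ}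

/-- The von Neumann entropy `-∑ λ log₂ λ` in bits, summed over the eigenvalues with multiplicity
(`0 log₂ 0 = 0`). -/
noncomputable def vonNeumannEntropy {n : Type*} [Fintype n] [DecidableEq n]
    {ρ : Matrix n n ℂ} (h : ρ.IsHermitian) : ℝ :=
  -∑ i, h.eigenvalues i * Real.logb 2 (h.eigenvalues i)

/-- The partial trace over the second system. -/
def traceB {a b : Type*} [Fintype b] (X : Matrix (a × b) (a × b) ℂ) : Matrix a a ℂ :=
  Matrix.of fun i j => ∑ k, X (i, k) (j, k)

/-- The partial trace over the first system. -/
def traceA {a b : Type*} [Fintype a] (X : Matrix (a × b) (a × b) ℂ) : Matrix b b ℂ :=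
  Matrix.of fun i j => ∑ k, X (k, i) (k, j)

/-- The map `X ↦ K X K†`. -/
def conj {m n : Type*} [Fintype n] (K : Matrix m n ℂ) :
    Matrix n n ℂ →ₗ[ℂ] Matrix m m ℂ where
  toFun X := K * X * Kᴴ
  map_add' X Y := by rw [Matrix.mul_add, Matrix.add_mul]
  map_smul' c X := by simp

/-- A quantum process: a completely positive trace-preserving map, in operator-sum (Kraus) form. -/
def IsChannel {m n : Type*} [Fintype m] [Fintype n] [DecidableEq n]
    (Φ : Matrix n n ℂ →ₗ[ℂ] Matrix m m ℂ) : Prop :=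
  ∃ (r : ℕ) (K : Fin r → Matrix m n ℂ), ∑ k, (K k)ᴴ * K k = 1 ∧ Φ = ∑ k, conj (K k)

/-- The quantum process `Φ` masks the states in `𝒮`: each marginal of the outputs is the same for
all states of `𝒮`, and one quantum process (the unmasking operator) recovers all of them. -/
structure Masks {a b c : Type*} [Fintype a] [DecidableEq a] [Fintype b] [DecidableEq b]
    [Fintype c] [DecidableEq c]
    (Φ : Matrix c c ℂ →ₗ[ℂ] Matrix (a × b) (a × b) ℂ) (𝒮 : Set (Matrix c c ℂ)) : Prop where
  isChannel : IsChannel Φ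
  marginalA : ∃ ρA : Matrix a a ℂ, ∀ φ ∈ 𝒮, traceB (Φ φ) = ρA
  marginalB : ∃ ρB : Matrix b b ℂ, ∀ φ ∈ 𝒮, traceA (Φ φ) = ρB
  unmask : ∃ U : Matrix (a × b) (a × b) ℂ →ₗ[ℂ] Matrix c c ℂ,
    IsChannel U ∧ ∀ φ ∈ 𝒮, U (Φ φ) = φ

/-- A universal quantum masker masks all quantum states of the input system. -/
def IsUniversalMasker {a b c : Type*} [Fintype a] [DecidableEq a] [Fintype b] [DecidableEq b]
    [Fintype c] [DecidableEq c]
    (Φ : Matrix c c ℂ →ₗ[ℂ] Matrix (a × b) (a × b) ℂ) : Prop :=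
  Masks Φ {ρ | IsState ρ}

/-- `ω` is a safe state of `Φ`: `Φ ρ = M (ρ ⊗ ω) M†` for all states `ρ`, with a masking operator
`M` from `CS` to `AB`. Only `M† M = 1` is required, which makes `M` unitary when `CS` and `AB`
have the same dimension; when they do not, `M` is unitary onto its range. -/
structure IsSafeState {a b c s : Type*} [Fintype a] [Fintype b]
    [Fintype c] [DecidableEq c] [Fintype s] [DecidableEq s]
    (Φ : Matrix c c ℂ →ₗ[ℂ] Matrix (a × b) (a × b) ℂ) (ω : Matrix s s ℂ) : Prop where
  isState : IsState ω
  dilation : ∃ M : Matrix (a × b) (c × s) ℂ, Mᴴ * M = 1 ∧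
    ∀ ρ : Matrix c c ℂ, IsState ρ → Φ ρ = M * (ρ ⊗ₖ ω) * Mᴴ

theorem IsSafeState.isHermitian {a b c s : Type*} [Fintype a] [Fintype b]
    [Fintype c] [DecidableEq c] [Fintype s] [DecidableEq s]
    {Φ : Matrix c c ℂ →ₗ[ℂ] Matrix (a × b) (a × b) ℂ} {ω : Matrix s s ℂ}
    (h : IsSafeState Φ ω) : ω.IsHermitian :=
  h.isState.posSemidef.isHermitian

/-- Separable bipartite states: finite mixtures of product states. -/
def IsSeparable {a b : Type*} [Fintype a] [Fintype b]
    (X : Matrix (a × b) (a × b) ℂ) : Prop :=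
  ∃ (r : ℕ) (p : Fin r → ℝ) (σ : Fin r → Matrix a a ℂ) (τ : Fin r → Matrix b b ℂ),
    (∀ k, 0 ≤ p k) ∧ ∑ k, p k = 1 ∧ (∀ k, IsState (σ k)) ∧ (∀ k, IsState (τ k)) ∧
    X = ∑ k, (p k : ℂ) • (σ k ⊗ₖ τ k)

/-- Quantum-classical states: `∑ pⱼ σⱼ ⊗ |eⱼ⟩⟨eⱼ|` for some orthonormal basis `e` of the second
system. -/
def IsQuantumClassical {a b : Type*} [Fintype a] [Fintype b]
    (X : Matrix (a × b) (a × b) ℂ) : Prop :=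
  ∃ (e : OrthonormalBasis b ℂ (EuclideanSpace ℂ b)) (p : b → ℝ) (σ : b → Matrix a a ℂ),
    (∀ j, 0 ≤ p j) ∧ ∑ j, p j = 1 ∧ (∀ j, IsState (σ j)) ∧
    X = ∑ j, (p j : ℂ) • (σ j ⊗ₖ ketbra (e j))

/-- Classically correlated states: `∑ pᵢⱼ |fᵢ⟩⟨fᵢ| ⊗ |eⱼ⟩⟨eⱼ|` for some orthonormal bases `f`, `e`
of the two systems and some joint probability distribution `p`. -/
def IsClassicallyCorrelated {a b : Type*} [Fintype a] [Fintype b]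
    (X : Matrix (a × b) (a × b) ℂ) : Prop :=
  ∃ (f : OrthonormalBasis a ℂ (EuclideanSpace ℂ a))
    (e : OrthonormalBasis b ℂ (EuclideanSpace ℂ b)) (p : a → b → ℝ),
    (∀ i j, 0 ≤ p i j) ∧ ∑ i, ∑ j, p i j = 1 ∧
    X = ∑ i, ∑ j, (p i j : ℂ) • (ketbra (f i) ⊗ₖ ketbra (e j))

end Masking

open scoped Kronecker Matrix ComplexOrder

set_option linter.unusedSectionVars false

namespace Masking

/-! Factor the safe state as `ω = Q Qᴴ` and absorb `Q` into the masking isometry. This gives a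
tensor `L` with four legs: a reference R for the input, the outputs A and B, and a purification K.
Up to normalization it is a pure state with S(K) = S(ω). Masking makes R maximally mixed and
uncorrelated with A and with B; the isometry property makes it uncorrelated with K. Complementary
parts of a pure state have the same nonzero spectrum, so subadditivity on AK, BK and AB gives log d
+ S(B) ≤ S(A) + S(K), log d + S(A) ≤ S(B) + S(K), log d + S(K) ≤ S(A) + S(B). The first two give
S(K) ≥ log d, which is (i); with the third, also S(A), S(B) ≥ log d. No-masking is the case of a
trivial ancilla, where S(K) = 0.

The other parts rest on commuting blocks. View an operator on AB as a matrix over A of operators on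
B. For a quantum-classical state these blocks commute; for a classically correlated one they commute
for both choices of the system. Reversibility gives the Knill-Laflamme condition, hence `Φ X * Φ Y =
0` exactly when `X * Y = 0`. If `X * P = 0` for a state `P`, polarizing the commutativity gives only
a first-order identity between the blocks of `Φ P` and `Φ X`; the rigidity lemma
`slicesCommute_of_swap` turns it into genuine commutation.

For (iv), the blocks of the images of |i⟩⟨i| and |i⟩⟨j| then commute on both sides, so the images
commute. One order of the product vanishes, hence so does the other, contradicting |i⟩⟨i| |i⟩⟨j| ≠
0. For (iii), all blocks of all outputs commute jointly, so the state of RA and B is separable and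
S(K) = S(RAB) ≥ S(RA) = log d + S(A) ≥ 2 log d. For (ii), if S(ω) ≤ log d, every pure output is
separable with entropy at most that of each marginal. The equality case in
`inner_eq_zero_or_norm_inner_eq_one` then forces commuting blocks on both sides, and the
contradiction of (iv) applies. -/

/-- The sum of `g` over the real parts of the eigenvalues of `ρ`, counted with algebraic
multiplicity. -/
noncomputable def spectralSum {n : Type*} [Fintype n] [DecidableEq n] (g : ℝ → ℝ)
    (ρ : Matrix n n ℂ) : ℝ :=
  (ρ.charpoly.roots.map fun z => g z.re).sum

/-- A doubly stochastic map increases the sum of a concave function. -/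
lemma sum_le_sum_of_doublyStochastic {m n : Type*} [Fintype m] [Fintype n]
    {g : ℝ → ℝ} {s : Set ℝ} (hg : ConcaveOn ℝ s g)
    {D : m → n → ℝ} (hD : ∀ i j, 0 ≤ D i j) (hrow : ∀ i, ∑ j, D i j = 1)
    (hcol : ∀ j, ∑ i, D i j = 1) {x : n → ℝ} (hx : ∀ j, x j ∈ s) {y : m → ℝ}
    (hy : ∀ i, y i = ∑ j, D i j * x j) : ∑ j, g (x j) ≤ ∑ i, g (y i) := by
  calc ∑ j, g (x j) = ∑ i, ∑ j, D i j * g (x j) := by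
        rw [Finset.sum_comm]
        simp [← Finset.sum_mul, hcol]
    _ ≤ ∑ i, g (y i) := by
        refine Finset.sum_le_sum fun i _ => ?_
        rw [hy]
        exact hg.le_map_sum (fun j _ => hD i j) (hrow i) fun j _ => hx j

/-! ### Spectral sums and Schur multiplication -/

section SpectralSum

variable {m n : Type*} [Fintype m] [DecidableEq m] [Fintype n] [DecidableEq n]

lemma spectralSum_eq_sum_eigenvalues (g : ℝ → ℝ) {ρ : Matrix n n ℂ} (h : ρ.IsHermitian) :
    spectralSum g ρ = ∑ i, g (h.eigenvalues i) := by
  rw [spectralSum, h.roots_charpoly_eq_eigenvalues, Multiset.map_map]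
  rfl

/-- The characteristic polynomials of the two products agree up to powers of `X`, and `g 0 = 0`
discards the extra zero roots. Every passage between complementary parts of a pure state uses this.
-/
lemma spectralSum_mul_comm {g : ℝ → ℝ} (hg : g 0 = 0) (A : Matrix m n ℂ) (B : Matrix n m ℂ) :
    spectralSum g (A * B) = spectralSum g (B * A) := by
  have key := congrArg (fun p => (p.roots.map fun z => g z.re).sum) (Matrix.charpoly_mul_comm' A B)
  have h (k : ℕ) {p : Polynomial ℂ} (hp : p.Monic) :
      (((Polynomial.X ^ k * p).roots).map fun z : ℂ => g z.re).sum
        = (p.roots.map fun z => g z.re).sum := by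
    rw [Polynomial.roots_mul (mul_ne_zero (pow_ne_zero _ Polynomial.X_ne_zero) hp.ne_zero)]
    simp [hg, Multiset.map_nsmul, Multiset.sum_nsmul]
  simp only [h _ (Matrix.charpoly_monic _)] at key
  exact key

lemma spectralSum_transpose (g : ℝ → ℝ) (A : Matrix n n ℂ) :
    spectralSum g Aᵀ = spectralSum g A := by
  rw [spectralSum, Matrix.charpoly_transpose, spectralSum]

lemma spectralSum_diagonal (g : ℝ → ℝ) (f : n → ℂ) :
    spectralSum g (Matrix.diagonal f) = ∑ i, g (f i).re := by
  rw [spectralSum, Matrix.charpoly_diagonal]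
  rw [Polynomial.roots_prod _ _ (Finset.prod_ne_zero_iff.2 fun i _ => Polynomial.X_sub_C_ne_zero _)]
  simp

lemma spectralSum_submatrix_equiv (g : ℝ → ℝ) (e : m ≃ n) (A : Matrix n n ℂ) :
    spectralSum g (A.submatrix e e) = spectralSum g A := by
  have := Matrix.charpoly_reindex e.symm A
  rw [spectralSum, spectralSum, ← this]
  rfl

lemma spectralSum_conj {g : ℝ → ℝ} (hg : g 0 = 0) {U : Matrix m n ℂ} (hU : Uᴴ * U = 1)
    (A : Matrix n n ℂ) : spectralSum g (U * A * Uᴴ) = spectralSum g A := by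
  rw [spectralSum_mul_comm hg, ← Matrix.mul_assoc, hU, one_mul]

lemma vonNeumannEntropy_eq_spectralSum {ρ : Matrix n n ℂ} (h : ρ.IsHermitian) :
    vonNeumannEntropy h = spectralSum Real.negMulLog ρ / Real.log 2 := by
  rw [spectralSum_eq_sum_eigenvalues _ h, vonNeumannEntropy, Finset.sum_div,
    ← Finset.sum_neg_distrib]
  refine Finset.sum_congr rfl fun i _ => ?_
  rw [Real.negMulLog, Real.logb]
  ring

/-- The spectral theorem in matrix form. -/
lemma exists_unitary_diagonal {ρ : Matrix n n ℂ} (h : ρ.IsHermitian) :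
    ∃ U : Matrix n n ℂ, Uᴴ * U = 1 ∧ U * Uᴴ = 1 ∧
      ρ = U * Matrix.diagonal (fun i => (h.eigenvalues i : ℂ)) * Uᴴ := by
  refine ⟨h.eigenvectorUnitary, ?_, ?_, ?_⟩
  · exact Unitary.coe_star_mul_self _
  · exact Unitary.coe_mul_star_self _
  · conv_lhs => rw [h.spectral_theorem]
    rfl

lemma IsState.sum_eigenvalues {ρ : Matrix n n ℂ} (h : IsState ρ) :
    ∑ i, h.posSemidef.isHermitian.eigenvalues i = 1 := by
  have := h.posSemidef.isHermitian.trace_eq_sum_eigenvalues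
  rw [h.trace_eq_one] at this
  exact Complex.ofReal_injective (by push_cast; exact this.symm)

lemma IsState.eigenvalues_mem {ρ : Matrix n n ℂ} (h : IsState ρ) (i : n) :
    h.posSemidef.isHermitian.eigenvalues i ∈ Set.Icc (0 : ℝ) 1 := by
  refine ⟨h.posSemidef.eigenvalues_nonneg i, ?_⟩
  rw [← h.sum_eigenvalues]
  exact Finset.single_le_sum (f := h.posSemidef.isHermitian.eigenvalues)
    (fun j _ => h.posSemidef.eigenvalues_nonneg j) (Finset.mem_univ i)

/-- Schur multiplication by a correlation matrix increases the sum of a concave function over the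
spectrum. -/
lemma spectralSum_le_spectralSum_hadamard {k : Type*} [Fintype k] {g : ℝ → ℝ}
    (hg : ConcaveOn ℝ (Set.Icc 0 1) g)
    {G : Matrix n n ℂ} (hG : IsState G) {Y : Matrix k n ℂ} (hY : ∀ l, (Yᴴ * Y) l l = 1) :
    spectralSum g G ≤ spectralSum g (Matrix.hadamard G (Yᴴ * Y)) := by
  have hGh := hG.posSemidef.isHermitian
  have hH : (Matrix.hadamard G (Yᴴ * Y)).IsHermitian := by
    ext i j
    have h1 := hGh.apply i j
    have h2 := (Matrix.isHermitian_conjTranspose_mul_self Y).apply i j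
    simp only [Matrix.conjTranspose_apply, Matrix.hadamard_apply, star_mul', h1, h2]
  obtain ⟨V, hV, hV', hGV⟩ := exists_unitary_diagonal hGh
  obtain ⟨U, hU, hU', hHU⟩ := exists_unitary_diagonal hH
  rw [spectralSum_eq_sum_eigenvalues g hGh, spectralSum_eq_sum_eigenvalues g hH]
  set γ := hGh.eigenvalues
  set μ := hH.eigenvalues
  -- Schur multiplication by `Yᴴ * Y` has the diagonal Kraus operators `diagonal (Y b)`; `W`
  -- expresses them in eigenbases of the input and of the output. As `Yᴴ * Y` has unit diagonal, the
  -- map is unital and trace preserving, so the squared moduli of `W` sum to a doubly stochastic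
  -- matrix relating the two spectra.
  let W : k → Matrix n n ℂ := fun b => Vᴴ * Matrix.diagonal (Y b) * U
  have hsum (X : Matrix n n ℂ) :
      ∑ b, (Matrix.diagonal (Y b))ᴴ * X * Matrix.diagonal (Y b) = Matrix.hadamard X (Yᴴ * Y) := by
    ext i l
    simp only [Matrix.sum_apply, Matrix.diagonal_conjTranspose, Matrix.mul_diagonal,
      Matrix.diagonal_mul, Matrix.hadamard_apply, Matrix.mul_apply (M := Yᴴ),
      Matrix.conjTranspose_apply, Finset.mul_sum, Pi.star_apply]
    exact Finset.sum_congr rfl fun b _ => by ring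
  have hsum' (X : Matrix n n ℂ) : ∑ b, (W b)ᴴ * (Vᴴ * X * V) * W b
      = Uᴴ * Matrix.hadamard X (Yᴴ * Y) * U := by
    rw [← hsum, Matrix.mul_sum, Matrix.sum_mul]
    refine Finset.sum_congr rfl fun b _ => ?_
    simp only [W, Matrix.conjTranspose_mul, Matrix.conjTranspose_conjTranspose]
    calc _ = Uᴴ * ((Matrix.diagonal (Y b))ᴴ * ((V * Vᴴ) * X * (V * Vᴴ)) *
          Matrix.diagonal (Y b)) * U := by
            simp only [mul_assoc]
      _ = _ := by simp only [hV', one_mul, mul_one, mul_assoc]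
  have hone : Matrix.hadamard (1 : Matrix n n ℂ) (Yᴴ * Y) = 1 := by
    ext i l
    rcases eq_or_ne i l with rfl | h
    · simp [hY]
    · simp [h]
  have hrow : ∑ b, (W b)ᴴ * W b = 1 := by
    have := hsum' 1
    rwa [hone, mul_one, mul_one, hV, hU, Finset.sum_congr rfl fun b _ => by rw [mul_one]] at this
  have hcol : ∑ b, W b * (W b)ᴴ = 1 := by
    have hs : ∑ b, Matrix.diagonal (Y b) * (Matrix.diagonal (Y b))ᴴ = (1 : Matrix n n ℂ) := by
      rw [← hone, ← hsum 1]
      refine Finset.sum_congr rfl fun b _ => ?_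
      rw [mul_one, Matrix.diagonal_conjTranspose, Matrix.diagonal_mul_diagonal,
        Matrix.diagonal_mul_diagonal]
      simp only [mul_comm]
    calc _ = Vᴴ * (∑ b, Matrix.diagonal (Y b) * (Matrix.diagonal (Y b))ᴴ) * V := by
            rw [Matrix.mul_sum, Matrix.sum_mul]
            refine Finset.sum_congr rfl fun b _ => ?_
            simp only [W, Matrix.conjTranspose_mul, Matrix.conjTranspose_conjTranspose]
            calc _ = Vᴴ * (Matrix.diagonal (Y b) * (U * Uᴴ) * (Matrix.diagonal (Y b))ᴴ) * V := by
                    simp only [mul_assoc]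
              _ = _ := by rw [hU', mul_one]
      _ = 1 := by rw [hs, mul_one, hV]
  have hdiag : ∑ b, (W b)ᴴ * Matrix.diagonal (fun i => (γ i : ℂ)) * W b
      = Matrix.diagonal fun i => (μ i : ℂ) := by
    have h1 : Vᴴ * G * V = Matrix.diagonal (fun i => (γ i : ℂ)) := by
      rw [hGV]
      calc _ = (Vᴴ * V) * Matrix.diagonal (fun i => (γ i : ℂ)) * (Vᴴ * V) := by
            simp only [mul_assoc]
        _ = _ := by rw [hV, one_mul, mul_one]
    have h2 : Uᴴ * Matrix.hadamard G (Yᴴ * Y) * U = Matrix.diagonal (fun i => (μ i : ℂ)) := by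
      rw [hHU]
      calc _ = (Uᴴ * U) * Matrix.diagonal (fun i => (μ i : ℂ)) * (Uᴴ * U) := by
            simp only [mul_assoc]
        _ = _ := by rw [hU, one_mul, mul_one]
    rw [← h1, hsum', h2]
  refine sum_le_sum_of_doublyStochastic hg (D := fun i j => ∑ b, Complex.normSq (W b j i))
    (fun i j => Finset.sum_nonneg fun b _ => Complex.normSq_nonneg _) (fun i => ?_) (fun j => ?_)
    (fun j => hG.eigenvalues_mem j) (fun i => ?_)
  · have := congrFun (congrFun hrow i) i
    simp only [Matrix.sum_apply, Matrix.mul_apply, Matrix.conjTranspose_apply,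
      Matrix.one_apply_eq] at this
    rw [Finset.sum_comm]
    refine Complex.ofReal_injective ?_
    push_cast
    rw [← this]
    simp only [← Complex.mul_conj, mul_comm]
    rfl
  · have := congrFun (congrFun hcol j) j
    simp only [Matrix.sum_apply, Matrix.mul_apply, Matrix.conjTranspose_apply,
      Matrix.one_apply_eq] at this
    rw [Finset.sum_comm]
    refine Complex.ofReal_injective ?_
    push_cast
    rw [← this]
    simp only [← Complex.mul_conj]
    rfl
  · have := congrFun (congrFun hdiag i) i
    simp only [Matrix.sum_apply, Matrix.mul_apply (N := W _), Matrix.mul_diagonal,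
      Matrix.conjTranspose_apply, Matrix.diagonal_apply_eq] at this
    refine Complex.ofReal_injective ?_
    push_cast
    simp only [Finset.sum_mul]
    rw [← this, Finset.sum_comm]
    refine Finset.sum_congr rfl fun j _ => Finset.sum_congr rfl fun b _ => ?_
    rw [← Complex.mul_conj, ← starRingEnd_apply]
    ring

/-- Schur multiplication by the identity is the pinching to the diagonal. -/
lemma spectralSum_le_sum_diag {g : ℝ → ℝ} (hg : ConcaveOn ℝ (Set.Icc 0 1) g)
    {G : Matrix n n ℂ} (hG : IsState G) : spectralSum g G ≤ ∑ i, g (G i i).re := by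
  have h := spectralSum_le_spectralSum_hadamard hg hG (Y := (1 : Matrix n n ℂ)) (by simp)
  have h' : Matrix.hadamard G ((1 : Matrix n n ℂ)ᴴ * 1) = Matrix.diagonal fun i => G i i := by
    ext i j
    rcases eq_or_ne i j with rfl | hij
    · simp
    · simp [hij]
  rwa [h', spectralSum_diagonal] at h

end SpectralSum

/-! ### Concavity and subadditivity of entropy -/

lemma concaveOn_negMulLog_Icc : ConcaveOn ℝ (Set.Icc 0 1) Real.negMulLog :=
  Real.concaveOn_negMulLog.subset Set.Icc_subset_Ici_self (convex_Icc 0 1)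

/-- The function `-x log x + x² / 2` is concave on the unit interval. -/
lemma concaveOn_negMulLog_add_sq :
    ConcaveOn ℝ (Set.Icc 0 1) fun x => Real.negMulLog x + x ^ 2 / 2 := by
  have hd (x : ℝ) (hx : x ∈ Set.Ioo (0 : ℝ) 1) :
      HasDerivAt (fun x => Real.negMulLog x + x ^ 2 / 2) (-Real.log x - 1 + x) x := by
    refine ((Real.hasDerivAt_negMulLog hx.1.ne').add
      ((hasDerivAt_pow 2 x).div_const 2)).congr_deriv ?_
    norm_num
  refine AntitoneOn.concaveOn_of_deriv (convex_Icc 0 1) (by fun_prop) ?_ ?_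
  · rw [interior_Icc]
    exact fun x hx => (hd x hx).differentiableAt.differentiableWithinAt
  · rw [interior_Icc]
    intro x hx y hy hxy
    rw [(hd x hx).deriv, (hd y hy).deriv]
    -- The derivative is antitone because `log x - log y ≤ (x - y) / y ≤ x - y` when `x ≤ y ≤ 1`.
    -- The quadratic term fits since the second derivative of `negMulLog` is at most -1 on this
    -- interval; it later detects the equality case.
    have h1 := Real.log_le_sub_one_of_pos (div_pos hx.1 hy.1)
    rw [Real.log_div hx.1.ne' hy.1.ne'] at h1
    have h2 : x / y - 1 ≤ x - y := by
      rw [div_sub_one hy.1.ne', div_le_iff₀ hy.1]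
      nlinarith [hy.1, hy.2]
    linarith

section

variable {m n : Type*} [Fintype m] [DecidableEq m] [Fintype n] [DecidableEq n]

lemma trace_traceB (X : Matrix (m × n) (m × n) ℂ) : (traceB X).trace = X.trace := by
  simp [traceB, Matrix.trace, Fintype.sum_prod_type]

lemma trace_traceA (X : Matrix (m × n) (m × n) ℂ) : (traceA X).trace = X.trace := by
  simp [traceA, Matrix.trace, Fintype.sum_prod_type_right]

/-- Subadditivity of the Shannon entropy. -/
lemma sum_negMulLog_le {q : m → n → ℝ} (hq : ∀ i j, 0 ≤ q i j) (h1 : ∑ i, ∑ j, q i j = 1) :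
    ∑ i, ∑ j, Real.negMulLog (q i j) ≤
      ∑ i, Real.negMulLog (∑ j, q i j) + ∑ j, Real.negMulLog (∑ i, q i j) := by
  set α : m → ℝ := fun i => ∑ j, q i j with hα
  set β : n → ℝ := fun j => ∑ i, q i j with hβ
  have hβ1 : ∑ j, β j = 1 := by rw [← h1, Finset.sum_comm]
  -- Gibbs' inequality term by term: `log r ≤ r - 1` at `r = α i * β j / q i j`. After summation `α
  -- i * β j` and `q i j` both total 1 and cancel.
  have key (i : m) (j : n) : Real.negMulLog (q i j) ≤
      α i * β j - q i j - q i j * Real.log (α i) - q i j * Real.log (β j) := by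
    have hqα : q i j ≤ α i :=
      Finset.single_le_sum (f := q i) (fun l _ => hq i l) (Finset.mem_univ j)
    have hqβ : q i j ≤ β j :=
      Finset.single_le_sum (f := fun l => q l j) (fun l _ => hq l j) (Finset.mem_univ i)
    rcases (hq i j).eq_or_lt with h | h
    · rw [← h] at hqα hqβ ⊢
      simpa using mul_nonneg hqα hqβ
    · have ha := h.trans_le hqα
      have hb := h.trans_le hqβ
      have := Real.log_le_sub_one_of_pos (div_pos (mul_pos ha hb) h)
      rw [Real.log_div (mul_pos ha hb).ne' h.ne', Real.log_mul ha.ne' hb.ne'] at this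
      have h2 := mul_le_mul_of_nonneg_left this h.le
      have h3 : q i j * (α i * β j / q i j - 1) = α i * β j - q i j := by field_simp
      rw [h3] at h2
      rw [Real.negMulLog]
      linarith
  refine (Finset.sum_le_sum fun i _ => Finset.sum_le_sum fun j _ => key i j).trans (le_of_eq ?_)
  simp only [Finset.sum_sub_distrib, ← Finset.mul_sum, hβ1, ← Finset.sum_mul, h1]
  have e1 : ∑ i, ∑ j, q i j * Real.log (β j) = ∑ j, β j * Real.log (β j) := by
    rw [Finset.sum_comm]
    simp only [hβ, Finset.sum_mul]
  rw [e1]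
  simp only [mul_one, Real.negMulLog, neg_mul, Finset.sum_neg_distrib]
  simp only [hα, hβ]
  rw [h1]
  ring

lemma IsState.conj {ρ : Matrix n n ℂ} (h : IsState ρ) {U : Matrix m n ℂ} (hU : Uᴴ * U = 1) :
    IsState (U * ρ * Uᴴ) where
  posSemidef := h.posSemidef.mul_mul_conjTranspose_same U
  trace_eq_one := by
    rw [Matrix.trace_mul_comm, ← Matrix.mul_assoc, hU, one_mul, h.trace_eq_one]

lemma isHermitian_traceA {X : Matrix (m × n) (m × n) ℂ} (h : X.IsHermitian) :
    (traceA X).IsHermitian := by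
  ext i j
  simp only [traceA, Matrix.conjTranspose_apply, Matrix.of_apply, star_sum]
  exact Finset.sum_congr rfl fun k _ => h.apply _ _

lemma isHermitian_traceB {X : Matrix (m × n) (m × n) ℂ} (h : X.IsHermitian) :
    (traceB X).IsHermitian := by
  ext i j
  simp only [traceB, Matrix.conjTranspose_apply, Matrix.of_apply, star_sum]
  exact Finset.sum_congr rfl fun k _ => h.apply _ _

lemma traceB_conj_kronecker {m' n' : Type*} [Fintype m'] [Fintype n']
    (U : Matrix m' m ℂ) {V : Matrix n' n ℂ} (hV : Vᴴ * V = 1)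
    (X : Matrix (m × n) (m × n) ℂ) :
    traceB ((U ⊗ₖ V) * X * (U ⊗ₖ V)ᴴ) = U * traceB X * Uᴴ := by
  have hVs (q s : n) : ∑ k, V k s * star (V k q) = if q = s then 1 else 0 := by
    have := congrFun (congrFun hV q) s
    simp only [Matrix.mul_apply, Matrix.conjTranspose_apply, Matrix.one_apply] at this
    simpa only [mul_comm] using this
  ext i j
  simp only [traceB, Matrix.of_apply, Matrix.mul_apply, Matrix.conjTranspose_apply,
    Matrix.kroneckerMap_apply, Fintype.sum_prod_type, Finset.sum_mul, Finset.mul_sum, star_mul']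
  rw [Finset.sum_comm]
  refine Finset.sum_congr rfl fun p _ => ?_
  calc _ = ∑ q, ∑ r, ∑ s, U i r * X (r, s) (p, q) * star (U j p) *
        ∑ k, V k s * star (V k q) := by
        rw [Finset.sum_comm]
        refine Finset.sum_congr rfl fun q _ => ?_
        rw [Finset.sum_comm]
        refine Finset.sum_congr rfl fun r _ => ?_
        rw [Finset.sum_comm]
        refine Finset.sum_congr rfl fun s _ => ?_
        rw [Finset.mul_sum]
        exact Finset.sum_congr rfl fun k _ => by ring
    _ = _ := by
        simp only [hVs, mul_ite, mul_one, mul_zero, Finset.sum_ite_eq, Finset.mem_univ, if_true]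
        exact Finset.sum_comm

lemma traceA_conj_kronecker {m' n' : Type*} [Fintype m'] [Fintype n']
    {U : Matrix m' m ℂ} (hU : Uᴴ * U = 1) (V : Matrix n' n ℂ)
    (X : Matrix (m × n) (m × n) ℂ) :
    traceA ((U ⊗ₖ V) * X * (U ⊗ₖ V)ᴴ) = V * traceA X * Vᴴ := by
  have h (Z : Matrix (m × n) (m × n) ℂ) : traceA Z = traceB (Z.submatrix Prod.swap Prod.swap) := rfl
  have h' (Z : Matrix (m' × n') (m' × n') ℂ) :
      traceA Z = traceB (Z.submatrix Prod.swap Prod.swap) := rfl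
  rw [h, h', ← traceB_conj_kronecker V hU]
  congr 1
  rw [← Matrix.submatrix_mul_equiv _ _ _ (Equiv.prodComm n m),
    ← Matrix.submatrix_mul_equiv _ _ _ (Equiv.prodComm n m)]
  congr 2
  · ext i j
    simp [mul_comm]
  · ext i j
    simp [mul_comm]

/-- Subadditivity of the von Neumann entropy. -/
lemma spectralSum_negMulLog_le {ρ : Matrix (m × n) (m × n) ℂ} (h : IsState ρ) :
    spectralSum Real.negMulLog ρ ≤
      spectralSum Real.negMulLog (traceB ρ) + spectralSum Real.negMulLog (traceA ρ) := by
  have hA := isHermitian_traceB h.posSemidef.isHermitian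
  have hB := isHermitian_traceA h.posSemidef.isHermitian
  -- A local rotation to eigenbases of the marginals makes the diagonal of `ρ` a joint distribution
  -- whose marginal distributions are the two marginal spectra. Pinching to that diagonal only
  -- raises the entropy, and the Shannon inequality finishes.
  obtain ⟨U, hU, hU', hAU⟩ := exists_unitary_diagonal hA
  obtain ⟨V, hV, hV', hBV⟩ := exists_unitary_diagonal hB
  have hW : ((Uᴴ ⊗ₖ Vᴴ)ᴴ) * (Uᴴ ⊗ₖ Vᴴ) = 1 := by
    rw [Matrix.conjTranspose_kronecker, Matrix.conjTranspose_conjTranspose,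
      Matrix.conjTranspose_conjTranspose, ← Matrix.mul_kronecker_mul, hU', hV',
      Matrix.one_kronecker_one]
  have hσ := h.conj hW
  rw [← spectralSum_conj Real.negMulLog_zero hW]
  refine (spectralSum_le_sum_diag concaveOn_negMulLog_Icc hσ).trans ?_
  have mA : traceB ((Uᴴ ⊗ₖ Vᴴ) * ρ * (Uᴴ ⊗ₖ Vᴴ)ᴴ)
      = Matrix.diagonal fun i => (hA.eigenvalues i : ℂ) := by
    rw [traceB_conj_kronecker _ (by rwa [Matrix.conjTranspose_conjTranspose])]
    conv_lhs => rw [hAU]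
    calc _ = (Uᴴ * U) * Matrix.diagonal (fun i => (hA.eigenvalues i : ℂ)) * (Uᴴ * U) := by
          simp only [mul_assoc, Matrix.conjTranspose_conjTranspose]
      _ = _ := by rw [hU, one_mul, mul_one]
  have mB : traceA ((Uᴴ ⊗ₖ Vᴴ) * ρ * (Uᴴ ⊗ₖ Vᴴ)ᴴ)
      = Matrix.diagonal fun i => (hB.eigenvalues i : ℂ) := by
    rw [traceA_conj_kronecker (by rwa [Matrix.conjTranspose_conjTranspose])]
    conv_lhs => rw [hBV]
    calc _ = (Vᴴ * V) * Matrix.diagonal (fun i => (hB.eigenvalues i : ℂ)) * (Vᴴ * V) := by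
          simp only [mul_assoc, Matrix.conjTranspose_conjTranspose]
      _ = _ := by rw [hV, one_mul, mul_one]
  generalize (Uᴴ ⊗ₖ Vᴴ) * ρ * (Uᴴ ⊗ₖ Vᴴ)ᴴ = σ at hσ mA mB
  rw [spectralSum_eq_sum_eigenvalues _ hA, spectralSum_eq_sum_eigenvalues _ hB,
    Fintype.sum_prod_type]
  have hre (i : m × n) : 0 ≤ (σ i i).re :=
    (Complex.nonneg_iff.1 hσ.posSemidef.diag_nonneg).1
  have htr : ∑ i, ∑ j, (σ (i, j) (i, j)).re = 1 := by
    have := congrArg Complex.re hσ.trace_eq_one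
    simpa [Matrix.trace, Fintype.sum_prod_type] using this
  refine (sum_negMulLog_le (q := fun i j => (σ (i, j) (i, j)).re) (fun i j => hre _) htr).trans_eq
    (congrArg₂ (· + ·) ?_ ?_)
  · refine Finset.sum_congr rfl fun i _ => ?_
    have := congrArg Complex.re (congrFun (congrFun mA i) i)
    simp only [traceB, Matrix.of_apply, Complex.re_sum, Matrix.diagonal_apply_eq,
      Complex.ofReal_re] at this
    exact congrArg Real.negMulLog this
  · refine Finset.sum_congr rfl fun i _ => ?_
    have := congrArg Complex.re (congrFun (congrFun mB i) i)
    simp only [traceA, Matrix.of_apply, Complex.re_sum, Matrix.diagonal_apply_eq,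
      Complex.ofReal_re] at this
    exact congrArg Real.negMulLog this

end

/-! ### Product vectors and the entropy of separable states -/

section

variable {m n c k : Type*} [Fintype m] [DecidableEq m] [Fintype n] [DecidableEq n]
  [Fintype c] [DecidableEq c] [Fintype k] [DecidableEq k]

/-- The entropy of `1/d ⊗ ρ`, in nats. -/
lemma spectralSum_negMulLog_one_kronecker [Nonempty c] {ρ : Matrix n n ℂ} (h : ρ.IsHermitian)
    (h1 : ρ.trace = 1) :
    spectralSum Real.negMulLog ((Fintype.card c : ℂ)⁻¹ • ((1 : Matrix c c ℂ) ⊗ₖ ρ)) =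
      Real.log (Fintype.card c) + spectralSum Real.negMulLog ρ := by
  obtain ⟨U, hU, hU', hρ⟩ := exists_unitary_diagonal h
  have hs : ∑ i, h.eigenvalues i = 1 := by
    have := h.trace_eq_sum_eigenvalues
    rw [h1] at this
    exact Complex.ofReal_injective (by push_cast; exact this.symm)
  have hW : ((1 : Matrix c c ℂ) ⊗ₖ U)ᴴ * ((1 : Matrix c c ℂ) ⊗ₖ U) = 1 := by
    rw [Matrix.conjTranspose_kronecker, ← Matrix.mul_kronecker_mul, hU, Matrix.conjTranspose_one,
      one_mul, Matrix.one_kronecker_one]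
  have hd : (Fintype.card c : ℂ)⁻¹ • ((1 : Matrix c c ℂ) ⊗ₖ ρ) = ((1 : Matrix c c ℂ) ⊗ₖ U) *
      Matrix.diagonal (fun i : c × n =>
        (((Fintype.card c : ℝ)⁻¹ * h.eigenvalues i.2 : ℝ) : ℂ)) * ((1 : Matrix c c ℂ) ⊗ₖ U)ᴴ := by
    have : Matrix.diagonal (fun i : c × n => (((Fintype.card c : ℝ)⁻¹ * h.eigenvalues i.2 : ℝ) : ℂ))
        = (Fintype.card c : ℂ)⁻¹ • ((1 : Matrix c c ℂ) ⊗ₖ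
          Matrix.diagonal fun i => (h.eigenvalues i : ℂ)) := by
      rw [← Matrix.diagonal_one, Matrix.diagonal_kronecker_diagonal, ← Matrix.diagonal_smul]
      congr 1
      ext i
      simp
    rw [this, Matrix.mul_smul, Matrix.smul_mul, Matrix.conjTranspose_kronecker,
      ← Matrix.mul_kronecker_mul, ← Matrix.mul_kronecker_mul, ← hρ, Matrix.conjTranspose_one,
      one_mul, one_mul]
  rw [hd, spectralSum_conj Real.negMulLog_zero hW, spectralSum_diagonal,
    spectralSum_eq_sum_eigenvalues _ h, Fintype.sum_prod_type]
  have hc : (Fintype.card c : ℝ) ≠ 0 := Nat.cast_ne_zero.2 Fintype.card_ne_zero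
  simp only [Complex.ofReal_re, Real.negMulLog_mul, Finset.sum_add_distrib, ← Finset.mul_sum,
    ← Finset.sum_mul, hs, Finset.sum_const, Finset.card_univ, nsmul_eq_mul]
  rw [Real.negMulLog, Real.log_inv]
  field_simp

lemma spectralSum_sq {ρ : Matrix n n ℂ} (h : ρ.IsHermitian) :
    spectralSum (fun x => x ^ 2) ρ = (ρ * ρ).trace.re := by
  obtain ⟨U, hU, hU', hρ⟩ := exists_unitary_diagonal h
  rw [spectralSum_eq_sum_eigenvalues _ h]
  have : (ρ * ρ).trace = ∑ i, ((h.eigenvalues i ^ 2 : ℝ) : ℂ) := by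
    set Λ := Matrix.diagonal fun i => (h.eigenvalues i : ℂ) with hΛ
    calc (ρ * ρ).trace = (U * (Λ * Λ * Uᴴ)).trace := by
          conv_lhs => rw [hρ]
          congr 1
          calc _ = U * Λ * (Uᴴ * U) * Λ * Uᴴ := by simp only [mul_assoc]
            _ = _ := by rw [hU]; simp only [mul_one, mul_assoc]
      _ = (Λ * Λ).trace := by rw [Matrix.trace_mul_comm, mul_assoc, hU, mul_one]
      _ = _ := by
          rw [hΛ, Matrix.diagonal_mul_diagonal, Matrix.trace_diagonal]
          exact Finset.sum_congr rfl fun i _ => by push_cast; ring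
  rw [this, ← Complex.ofReal_sum, Complex.ofReal_re]

lemma spectralSum_negMulLog_add_sq {ρ : Matrix n n ℂ} (h : ρ.IsHermitian) :
    spectralSum (fun x => Real.negMulLog x + x ^ 2 / 2) ρ =
      spectralSum Real.negMulLog ρ + (ρ * ρ).trace.re / 2 := by
  rw [← spectralSum_sq h]
  simp only [spectralSum_eq_sum_eigenvalues _ h, Finset.sum_add_distrib, Finset.sum_div]

/-- The matrix whose columns are the product vectors `x_k ⊗ y_k`. -/
def productColumns (X : Matrix m k ℂ) (Y : Matrix n k ℂ) : Matrix (m × n) k ℂ :=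
  Matrix.of fun i l => X i.1 l * Y i.2 l

/-- Inner products of product vectors multiply. Thus a separable state has, up to zeros, the
spectrum of a Schur product of Gram matrices. -/
lemma gram_productColumns (X : Matrix m k ℂ) (Y : Matrix n k ℂ) :
    (productColumns X Y)ᴴ * productColumns X Y = Matrix.hadamard (Xᴴ * X) (Yᴴ * Y) := by
  ext i j
  simp only [productColumns, Matrix.mul_apply, Matrix.conjTranspose_apply, Matrix.of_apply,
    Fintype.sum_prod_type, Matrix.hadamard_apply, Finset.sum_mul_sum, star_mul']
  exact Finset.sum_congr rfl fun _ _ => Finset.sum_congr rfl fun _ _ => by ring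

lemma traceB_productColumns (X : Matrix m k ℂ) {Y : Matrix n k ℂ} (hY : ∀ l, (Yᴴ * Y) l l = 1) :
    traceB (productColumns X Y * (productColumns X Y)ᴴ) = X * Xᴴ := by
  ext i j
  simp only [traceB, productColumns, Matrix.mul_apply, Matrix.conjTranspose_apply, Matrix.of_apply,
    star_mul'] at hY ⊢
  rw [Finset.sum_comm]
  refine Finset.sum_congr rfl fun l _ => ?_
  calc _ = X i l * star (X j l) * ∑ x, star (Y x l) * Y x l := by
        rw [Finset.mul_sum]
        exact Finset.sum_congr rfl fun _ _ => by ring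
    _ = _ := by rw [hY, mul_one]

/-- A separable state is at least as disordered as its marginal. -/
lemma spectralSum_traceB_le {g : ℝ → ℝ} (hg : ConcaveOn ℝ (Set.Icc 0 1) g) (hg0 : g 0 = 0)
    (X : Matrix m k ℂ) {Y : Matrix n k ℂ} (hY : ∀ l, (Yᴴ * Y) l l = 1)
    (h1 : (X * Xᴴ).trace = 1) :
    spectralSum g (X * Xᴴ) ≤ spectralSum g (productColumns X Y * (productColumns X Y)ᴴ) := by
  rw [spectralSum_mul_comm hg0, spectralSum_mul_comm hg0 (productColumns X Y),
    gram_productColumns]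
  exact spectralSum_le_spectralSum_hadamard hg
    ⟨Matrix.posSemidef_conjTranspose_mul_self X, by rw [Matrix.trace_mul_comm, h1]⟩ hY

end

/-! ### Masking tensors and their entropy inequalities -/

section Purification

variable {a b c k : Type*} [Fintype a] [DecidableEq a] [Fintype b] [DecidableEq b]
  [Fintype c] [DecidableEq c] [Fintype k] [DecidableEq k]

/-- Inserting matrix units exposes the reference indices, so that the hiding conditions become
statements about reduced states that include the reference. -/
lemma mul_single_kronecker_one_mul_apply (L : Matrix (a × b) (c × k) ℂ) (r r' : c)
    (i j : a × b) :
    (L * (Matrix.single r r' (1 : ℂ) ⊗ₖ (1 : Matrix k k ℂ)) * Lᴴ) i j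
      = ∑ x, L i (r, x) * star (L j (r', x)) := by
  rw [Matrix.mul_apply, Fintype.sum_prod_type, Finset.sum_comm]
  refine Finset.sum_congr rfl fun x _ => ?_
  rw [Finset.sum_eq_single r' _ (by simp)]
  · rw [Matrix.mul_apply, Fintype.sum_prod_type, Finset.sum_eq_single r _ (by simp),
      Finset.sum_eq_single x _ (by simp)]
    · simp
    · intro y _ hy
      simp [hy]
    · intro y _ hy
      refine Finset.sum_eq_zero fun z _ => ?_
      simp [hy.symm]
  · intro y _ hy
    rw [Matrix.mul_apply, Finset.sum_eq_zero, zero_mul]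
    intro z _
    simp [hy.symm]

variable {L : Matrix (a × b) (c × k) ℂ} {κ : Matrix k k ℂ} {ρA : Matrix a a ℂ} {ρB : Matrix b b ℂ}

/-- A masking tensor: `L` encodes `c` and the purification `k` isometrically (up to the state `κ`),
and both marginals hide the input. -/
structure IsMaskingTensor (L : Matrix (a × b) (c × k) ℂ) (κ : Matrix k k ℂ) (ρA : Matrix a a ℂ)
    (ρB : Matrix b b ℂ) : Prop where
  isState : IsState κ
  gram : Lᴴ * L = 1 ⊗ₖ κ
  marginalA : ∀ X : Matrix c c ℂ,
    traceB (L * (X ⊗ₖ (1 : Matrix k k ℂ)) * Lᴴ) = X.trace • ρA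
  marginalB : ∀ X : Matrix c c ℂ,
    traceA (L * (X ⊗ₖ (1 : Matrix k k ℂ)) * Lᴴ) = X.trace • ρB

namespace IsMaskingTensor

lemma swap (h : IsMaskingTensor L κ ρA ρB) :
    IsMaskingTensor (L.submatrix Prod.swap id) κ ρB ρA where
  isState := h.isState
  gram := by
    rw [← h.gram, Matrix.conjTranspose_submatrix]
    exact Matrix.submatrix_mul_equiv Lᴴ L id (Equiv.prodComm b a) id
  marginalA X := h.marginalB X
  marginalB X := h.marginalA X

lemma traceB_mul (h : IsMaskingTensor L κ ρA ρB) :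
    traceB (L * Lᴴ) = (Fintype.card c : ℂ) • ρA := by
  have := h.marginalA 1
  rwa [Matrix.one_kronecker_one, Matrix.mul_one, Matrix.trace_one] at this

lemma isState_mul [Nonempty c] (h : IsMaskingTensor L κ ρA ρB) :
    IsState ((Fintype.card c : ℂ)⁻¹ • (L * Lᴴ)) where
  posSemidef := (Matrix.posSemidef_self_mul_conjTranspose L).smul (by positivity)
  trace_eq_one := by
    rw [Matrix.trace_smul, Matrix.trace_mul_comm, h.gram, Matrix.trace_kronecker,
      h.isState.trace_eq_one, Matrix.trace_one, mul_one, smul_eq_mul,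
      inv_mul_cancel₀ (Nat.cast_ne_zero.2 Fintype.card_ne_zero)]

lemma traceB_smul (z : ℂ) (X : Matrix (a × b) (a × b) ℂ) : traceB (z • X) = z • traceB X := by
  ext i j
  simp [traceB, Finset.mul_sum]

lemma traceA_smul (z : ℂ) (X : Matrix (a × b) (a × b) ℂ) : traceA (z • X) = z • traceA X := by
  ext i j
  simp [traceA, Finset.mul_sum]

lemma traceB_state [Nonempty c] (h : IsMaskingTensor L κ ρA ρB) :
    traceB ((Fintype.card c : ℂ)⁻¹ • (L * Lᴴ)) = ρA := by
  rw [traceB_smul, h.traceB_mul, smul_smul,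
    inv_mul_cancel₀ (Nat.cast_ne_zero.2 Fintype.card_ne_zero), one_smul]

lemma traceA_state [Nonempty c] (h : IsMaskingTensor L κ ρA ρB) :
    traceA ((Fintype.card c : ℂ)⁻¹ • (L * Lᴴ)) = ρB := h.swap.traceB_state

lemma isHermitian_left [Nonempty c] (h : IsMaskingTensor L κ ρA ρB) : ρA.IsHermitian := by
  rw [← h.traceB_state]
  exact isHermitian_traceB h.isState_mul.posSemidef.isHermitian

lemma trace_left [Nonempty c] (h : IsMaskingTensor L κ ρA ρB) : ρA.trace = 1 := by
  rw [← h.traceB_state, trace_traceB, h.isState_mul.trace_eq_one]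

/-- The entropy of the masked maximally mixed state is at most that of the marginals. -/
lemma log_card_add_le_add [Nonempty c] (h : IsMaskingTensor L κ ρA ρB) :
    Real.log (Fintype.card c) + spectralSum Real.negMulLog κ ≤
      spectralSum Real.negMulLog ρA + spectralSum Real.negMulLog ρB := by
  rw [← spectralSum_negMulLog_one_kronecker (c := c) h.isState.posSemidef.isHermitian
    h.isState.trace_eq_one, ← h.gram, ← Matrix.mul_smul,
    spectralSum_mul_comm Real.negMulLog_zero, Matrix.smul_mul]
  have := spectralSum_negMulLog_le h.isState_mul
  rwa [h.traceB_state, h.traceA_state] at this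

/-- The reference together with the second system is complementary to the first system together
with the purification. -/
lemma log_card_add_right_le [Nonempty c] (h : IsMaskingTensor L κ ρA ρB) :
    Real.log (Fintype.card c) + spectralSum Real.negMulLog ρB ≤
      spectralSum Real.negMulLog ρA + spectralSum Real.negMulLog κ := by
  have hc : (Fintype.card c : ℂ) ≠ 0 := Nat.cast_ne_zero.2 Fintype.card_ne_zero
  -- The legs of `L` regrouped across the cut RB | AK: `V * Vᴴ` and `Vᴴ * V` are the two
  -- complementary reduced states, up to normalization and transposition. The transpose in `hA` does
  -- not affect the spectrum.
  let V : Matrix (c × b) (a × k) ℂ := Matrix.of fun i j => L (j.1, i.2) (i.1, j.2)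
  have hV : V * Vᴴ = 1 ⊗ₖ ρB := by
    ext ⟨r, u⟩ ⟨r', u'⟩
    have := congrFun (congrFun (h.marginalB (Matrix.single r r' 1)) u) u'
    simp only [traceA, Matrix.of_apply, mul_single_kronecker_one_mul_apply] at this
    simp only [V, Matrix.mul_apply, Matrix.of_apply, Matrix.conjTranspose_apply,
      Fintype.sum_prod_type, this]
    rcases eq_or_ne r r' with rfl | hr
    · simp
    · simp [hr]
  have hA : traceB ((Fintype.card c : ℂ)⁻¹ • (Vᴴ * V)) = ρAᵀ := by
    rw [← h.traceB_state]
    ext i j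
    simp only [traceB, V, Matrix.mul_apply, Matrix.of_apply, Matrix.conjTranspose_apply,
      Fintype.sum_prod_type, Matrix.smul_apply, Matrix.transpose_apply, smul_eq_mul,
      ← Finset.mul_sum]
    congr 1
    rw [Finset.sum_comm]
    simp only [Finset.sum_comm (s := (Finset.univ : Finset k))]
    rw [Finset.sum_comm]
    exact Finset.sum_congr rfl fun _ _ => Finset.sum_congr rfl fun _ _ =>
      Finset.sum_congr rfl fun _ _ => mul_comm _ _
  have hK : traceA ((Fintype.card c : ℂ)⁻¹ • (Vᴴ * V)) = κ := by
    ext i j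
    have (r : c) := congrFun (congrFun h.gram (r, i)) (r, j)
    simp only [Matrix.mul_apply, Matrix.conjTranspose_apply, Matrix.kroneckerMap_apply,
      Matrix.one_apply_eq, one_mul, Fintype.sum_prod_type] at this
    simp only [traceA, V, Matrix.mul_apply, Matrix.of_apply, Matrix.conjTranspose_apply,
      Fintype.sum_prod_type, Matrix.smul_apply, smul_eq_mul, ← Finset.mul_sum]
    rw [Finset.sum_comm]
    simp only [this, Finset.sum_const, Finset.card_univ, nsmul_eq_mul]
    field_simp
  have hs : IsState ((Fintype.card c : ℂ)⁻¹ • (Vᴴ * V)) := by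
    refine ⟨(Matrix.posSemidef_conjTranspose_mul_self V).smul (by positivity), ?_⟩
    rw [← trace_traceA, hK, h.isState.trace_eq_one]
  have := spectralSum_negMulLog_le hs
  rw [hA, hK, spectralSum_transpose, ← Matrix.mul_smul,
    spectralSum_mul_comm Real.negMulLog_zero, Matrix.smul_mul, hV,
    spectralSum_negMulLog_one_kronecker h.swap.isHermitian_left h.swap.trace_left] at this
  exact this

/-- Adding the inequality for the cut RB | AK to the one with A and B exchanged cancels both
marginal entropies. -/
lemma log_card_le [Nonempty c] (h : IsMaskingTensor L κ ρA ρB) :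
    Real.log (Fintype.card c) ≤ spectralSum Real.negMulLog κ := by
  linarith [h.log_card_add_right_le, h.swap.log_card_add_right_le]

/-- Here the inequalities for the cuts RB | AK and AB | RK are added; the entropies of B and K
cancel. -/
lemma log_card_le_left [Nonempty c] (h : IsMaskingTensor L κ ρA ρB) :
    Real.log (Fintype.card c) ≤ spectralSum Real.negMulLog ρA := by
  linarith [h.log_card_add_right_le, h.log_card_add_le_add]

/-- The joint output of a masking tensor together with the reference system. -/
def jointOutput (L : Matrix (a × b) (c × k) ℂ) : Matrix ((c × a) × b) k ℂ :=
  Matrix.of fun i x => L (i.1.2, i.2) (i.1.1, x)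

lemma traceB_jointOutput (h : IsMaskingTensor L κ ρA ρB) :
    traceB (jointOutput L * (jointOutput L)ᴴ) = 1 ⊗ₖ ρA := by
  ext ⟨r, u⟩ ⟨r', u'⟩
  have := congrFun (congrFun (h.marginalA (Matrix.single r r' 1)) u) u'
  simp only [traceB, Matrix.of_apply, mul_single_kronecker_one_mul_apply] at this
  simp only [jointOutput, traceB, Matrix.mul_apply, Matrix.of_apply, Matrix.conjTranspose_apply,
    this]
  rcases eq_or_ne r r' with rfl | hr
  · simp
  · simp [hr]

lemma gram_jointOutput (h : IsMaskingTensor L κ ρA ρB) :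
    (jointOutput L)ᴴ * jointOutput L = (Fintype.card c : ℂ) • κ := by
  ext i j
  have (r : c) := congrFun (congrFun h.gram (r, i)) (r, j)
  simp only [Matrix.mul_apply, Matrix.conjTranspose_apply, Matrix.kroneckerMap_apply,
    Matrix.one_apply_eq, one_mul, Fintype.sum_prod_type] at this
  simp only [jointOutput, Matrix.mul_apply, Matrix.of_apply, Matrix.conjTranspose_apply,
    Fintype.sum_prod_type, this, Matrix.smul_apply]
  simp

/-- If the joint output is separable then its entropy dominates that of reference and first
system. -/
lemma log_card_add_left_le [Nonempty c] (h : IsMaskingTensor L κ ρA ρB) {l : Type*} [Fintype l]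
    [DecidableEq l] {X : Matrix (c × a) l ℂ} {Y : Matrix b l ℂ} (hY : ∀ i, (Yᴴ * Y) i i = 1)
    (hXY : jointOutput L * (jointOutput L)ᴴ = productColumns X Y * (productColumns X Y)ᴴ) :
    Real.log (Fintype.card c) + spectralSum Real.negMulLog ρA ≤ spectralSum Real.negMulLog κ := by
  have hc : (Fintype.card c : ℂ) ≠ 0 := Nat.cast_ne_zero.2 Fintype.card_ne_zero
  -- The joint output has trace `card c`; scaling the columns by the inverse square root normalizes
  -- it.
  let z : ℂ := ((Real.sqrt (Fintype.card c))⁻¹ : ℝ)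
  have hz : z * star z = (Fintype.card c : ℂ)⁻¹ := by
    have h2 : (Real.sqrt (Fintype.card c))⁻¹ * (Real.sqrt (Fintype.card c))⁻¹
        = (Fintype.card c : ℝ)⁻¹ := by
      rw [← mul_inv, Real.mul_self_sqrt (Nat.cast_nonneg _)]
    simp only [z, RCLike.star_def, Complex.conj_ofReal]
    rw [← Complex.ofReal_mul, h2, Complex.ofReal_inv, Complex.ofReal_natCast]
  have hprod : productColumns (z • X) Y = z • productColumns X Y := by
    ext i j
    simp [productColumns, mul_assoc]
  have hX : (z • X) * (z • X)ᴴ = (Fintype.card c : ℂ)⁻¹ • (1 ⊗ₖ ρA) := by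
    rw [← h.traceB_jointOutput, hXY, traceB_productColumns X hY, Matrix.conjTranspose_smul,
      Matrix.smul_mul, Matrix.mul_smul, smul_smul, hz]
  have htr : ((z • X) * (z • X)ᴴ).trace = 1 := by
    rw [hX, Matrix.trace_smul, Matrix.trace_kronecker, h.trace_left, Matrix.trace_one, mul_one,
      smul_eq_mul, inv_mul_cancel₀ hc]
  have key := spectralSum_traceB_le concaveOn_negMulLog_Icc Real.negMulLog_zero (z • X) hY htr
  rw [hX, spectralSum_negMulLog_one_kronecker h.isHermitian_left h.trace_left, hprod,
    Matrix.conjTranspose_smul, Matrix.smul_mul, Matrix.mul_smul, smul_smul, hz, ← hXY,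
    ← Matrix.smul_mul, spectralSum_mul_comm Real.negMulLog_zero, Matrix.mul_smul,
    h.gram_jointOutput, smul_smul, inv_mul_cancel₀ hc, one_smul] at key
  exact key

end IsMaskingTensor

end Purification

/-! ### Operators with commuting blocks -/

/-- Commuting Hermitian matrices are simultaneously unitarily diagonalizable. -/
lemma exists_unitary_diagonal_of_commute {ι n : Type*} [Fintype n] [DecidableEq n]
    {H : ι → Matrix n n ℂ} (hH : ∀ i, (H i).IsHermitian) (hc : ∀ i j, Commute (H i) (H j)) :
    ∃ E : Matrix n n ℂ, Eᴴ * E = 1 ∧ E * Eᴴ = 1 ∧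
      ∀ i, ∃ f : n → ℂ, H i = E * Matrix.diagonal f * Eᴴ := by
  classical
  let T : ι → Module.End ℂ (EuclideanSpace ℂ n) := fun i => Matrix.toEuclideanLin (H i)
  have hT (i : ι) : (T i).IsSymmetric := Matrix.isSymmetric_toEuclideanLin_iff.2 (hH i)
  have hTc : Pairwise (Function.onFun Commute T) := by
    intro i j _
    have h := (hc i j).eq
    refine LinearMap.ext fun v => ?_
    simp only [T, Module.End.mul_apply, Matrix.toLpLin_apply, Matrix.mulVec_mulVec]
    rw [h]
  have hint := LinearMap.IsSymmetric.directSum_isInternal_of_pairwise_commute hT hTc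
  set W : (ι → ℂ) → Submodule ℂ (EuclideanSpace ℂ n) := fun α => ⨅ j, (T j).eigenspace (α j)
  -- Joint eigenvalues range over the infinite type `ι → ℂ`; discarding the zero eigenspaces leaves
  -- a finite family, as the subordinate basis requires.
  have hfin : Finite {α // W α ≠ ⊥} :=
    WellFoundedGT.finite_ne_bot_of_iSupIndep hint.submodule_iSupIndep
  have : Fintype {α // W α ≠ ⊥} := Fintype.ofFinite _
  have hint' := DirectSum.isInternal_ne_bot_iff.2 hint
  have hort : OrthogonalFamily ℂ (fun α : {α // W α ≠ ⊥} => W α) fun α => (W α).subtypeₗᵢ :=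
    (LinearMap.IsSymmetric.orthogonalFamily_iInf_eigenspaces hT).comp Subtype.val_injective
  let e₀ := hint'.subordinateOrthonormalBasis (finrank_euclideanSpace (𝕜 := ℂ) (ι := n)) hort
  let e : OrthonormalBasis n ℂ (EuclideanSpace ℂ n) := e₀.reindex (Fintype.equivFin n).symm
  have he (i : ι) (j : n) : ∃ μ : ℂ, T i (e j) = μ • e j := by
    refine ⟨(hint'.subordinateOrthonormalBasisIndex (finrank_euclideanSpace (𝕜 := ℂ) (ι := n))
      (Fintype.equivFin n j) hort).1 i, ?_⟩
    have := hint'.subordinateOrthonormalBasis_subordinate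
      (finrank_euclideanSpace (𝕜 := ℂ) (ι := n)) (Fintype.equivFin n j) hort
    have h2 := (Submodule.mem_iInf _).1 this i
    rw [Module.End.mem_eigenspace_iff] at h2
    simpa [e, e₀] using h2
  choose μ hμ using he
  let E : Matrix n n ℂ := Matrix.of fun u j => e j u
  have hE : Eᴴ * E = 1 := by
    ext i j
    have := (orthonormal_iff_ite.1 e.orthonormal) i j
    rw [Matrix.one_apply, ← this, Matrix.mul_apply, PiLp.inner_apply]
    refine Finset.sum_congr rfl fun u _ => ?_
    simp [E, mul_comm]
  have hE' : E * Eᴴ = 1 := mul_eq_one_comm.1 hE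
  refine ⟨E, hE, hE', fun i => ⟨μ i, ?_⟩⟩
  have : H i * E = E * Matrix.diagonal (μ i) := by
    ext u j
    have := congrArg (fun v : EuclideanSpace ℂ n => v u) (hμ i j)
    simp only [T, Matrix.toLpLin_apply, Matrix.mulVec, dotProduct, PiLp.smul_apply,
      smul_eq_mul] at this
    rw [Matrix.mul_diagonal, Matrix.mul_apply]
    simp only [E, Matrix.of_apply]
    rw [mul_comm, ← this]
  rw [← this, mul_assoc, hE', mul_one]

section Slices

variable {a b : Type*} [Fintype a] [DecidableEq a] [Fintype b] [DecidableEq b]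

/-- The block of a bipartite operator with fixed indices of the first system. -/
def slice (N : Matrix (a × b) (a × b) ℂ) (x y : a) : Matrix b b ℂ :=
  Matrix.of fun u v => N (x, u) (y, v)

/-- All blocks of `P` commute with all blocks of `N`. -/
def SlicesCommute (P N : Matrix (a × b) (a × b) ℂ) : Prop :=
  ∀ x y z w, Commute (slice P x y) (slice N z w)

/-- Exchange the two systems of a bipartite operator. -/
def swapSystems (N : Matrix (a × b) (a × b) ℂ) : Matrix (b × a) (b × a) ℂ :=
  N.submatrix Prod.swap Prod.swap

lemma slice_mul (P N : Matrix (a × b) (a × b) ℂ) (x y : a) :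
    slice (P * N) x y = ∑ z, slice P x z * slice N z y := by
  ext u v
  simp [slice, Matrix.mul_apply, Fintype.sum_prod_type, Matrix.sum_apply]

lemma slice_conjTranspose (N : Matrix (a × b) (a × b) ℂ) (x y : a) :
    slice Nᴴ x y = (slice N y x)ᴴ := rfl

lemma traceA_eq_sum_slice (N : Matrix (a × b) (a × b) ℂ) : traceA N = ∑ x, slice N x x := by
  ext u v
  simp [slice, traceA, Matrix.sum_apply]

/-- Operators whose blocks commute with respect to both systems commute. -/
lemma SlicesCommute.mul_eq_mul {P N : Matrix (a × b) (a × b) ℂ} (hB : SlicesCommute P N)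
    (hA : SlicesCommute (swapSystems P) (swapSystems N)) : P * N = N * P := by
  ext ⟨x, u⟩ ⟨w, v⟩
  -- `h1` exchanges the factors along the second-system indices and `h2` along the first; together
  -- they reverse the whole product.
  have h1 (y : a) := congrFun (congrFun (hB x y y w).eq u) v
  have h2 (t : b) := congrFun (congrFun (hA t v u t).eq x) w
  simp only [slice, swapSystems, Matrix.mul_apply, Matrix.of_apply, Matrix.submatrix_apply,
    Prod.swap_prod_mk] at h1 h2
  simp only [Matrix.mul_apply, Fintype.sum_prod_type]
  simp only [h1]
  rw [Finset.sum_comm]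
  refine (Finset.sum_congr rfl fun t _ => ?_).trans Finset.sum_comm
  rw [← h2]
  exact Finset.sum_congr rfl fun y _ => mul_comm _ _

/-- A positive operator with commuting blocks is block diagonal in a basis of the second system. -/
lemma exists_blockDiagonal {P : Matrix (a × b) (a × b) ℂ} (hP : P.PosSemidef)
    (hc : SlicesCommute P P) :
    ∃ (E : Matrix b b ℂ) (R : b → Matrix a a ℂ), Eᴴ * E = 1 ∧ E * Eᴴ = 1 ∧
      (∀ j, (R j).PosSemidef) ∧
      ∀ x y, slice P x y = E * Matrix.diagonal (fun j => R j x y) * Eᴴ := by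
  have hadj (x y : a) : (slice P x y)ᴴ = slice P y x := by
    rw [← slice_conjTranspose, hP.isHermitian.eq]
  -- Single blocks need not be Hermitian, so their real and imaginary parts, up to factors, are
  -- diagonalized; each block is recovered as a combination of the two.
  let H : (a × a) ⊕ (a × a) → Matrix b b ℂ := Sum.elim
    (fun p => slice P p.1 p.2 + slice P p.2 p.1)
    (fun p => Complex.I • (slice P p.1 p.2 - slice P p.2 p.1))
  have hH (i) : (H i).IsHermitian := by
    rcases i with ⟨x, y⟩ | ⟨x, y⟩
    · simp [H, Matrix.IsHermitian, hadj, add_comm]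
    · simp only [H, Matrix.IsHermitian, Sum.elim_inr, Matrix.conjTranspose_smul,
        Matrix.conjTranspose_sub, hadj]
      ext u v
      simp
      ring
  have hHc (i j) : Commute (H i) (H j) := by
    rcases i with ⟨x, y⟩ | ⟨x, y⟩ <;> rcases j with ⟨z, w⟩ | ⟨z, w⟩
    · exact ((hc _ _ _ _).add_right (hc _ _ _ _)).add_left ((hc _ _ _ _).add_right (hc _ _ _ _))
    · exact (((hc _ _ _ _).sub_right (hc _ _ _ _)).add_left
        ((hc _ _ _ _).sub_right (hc _ _ _ _))).smul_right _
    · exact (((hc _ _ _ _).add_right (hc _ _ _ _)).sub_left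
        ((hc _ _ _ _).add_right (hc _ _ _ _))).smul_left _
    · exact ((((hc _ _ _ _).sub_right (hc _ _ _ _)).sub_left
        ((hc _ _ _ _).sub_right (hc _ _ _ _))).smul_right _).smul_left _
  obtain ⟨E, hE, hE', hd⟩ := exists_unitary_diagonal_of_commute hH hHc
  refine ⟨E, fun j => Matrix.of fun x y => (Eᴴ * slice P x y * E) j j, hE, hE', fun j => ?_,
    fun x y => ?_⟩
  -- `C` tensors with the `j`-th column of `E`; the compression by `C` is the `j`-th diagonal block,
  -- which is therefore positive.
  · let C : Matrix (a × b) a ℂ := Matrix.of fun i y => if i.1 = y then E i.2 j else 0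
    have : (Matrix.of fun x y => (Eᴴ * slice P x y * E) j j) = Cᴴ * P * C := by
      ext x y
      simp [C, Matrix.mul_apply, Fintype.sum_prod_type, slice, apply_ite star, ite_mul, Finset.sum_ite_irrel]
    change (Matrix.of fun x y => (Eᴴ * slice P x y * E) j j).PosSemidef
    rw [this]
    exact hP.conjTranspose_mul_mul_same C
  · obtain ⟨f, hf⟩ := hd (Sum.inl (x, y))
    obtain ⟨g, hg⟩ := hd (Sum.inr (x, y))
    have hs : slice P x y =
        E * Matrix.diagonal ((1 / 2 : ℂ) • f - (Complex.I / 2) • g) * Eᴴ := by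
      have e1 : Matrix.diagonal ((1 / 2 : ℂ) • f - (Complex.I / 2) • g) =
          (1 / 2 : ℂ) • Matrix.diagonal f - (Complex.I / 2) • Matrix.diagonal g := by
        rw [← Matrix.diagonal_smul, ← Matrix.diagonal_smul, Matrix.diagonal_sub]
        rfl
      rw [e1, mul_sub, sub_mul, Matrix.mul_smul, Matrix.mul_smul, Matrix.smul_mul,
        Matrix.smul_mul, ← hf, ← hg]
      simp only [H, Sum.elim_inl, Sum.elim_inr, smul_smul]
      have : Complex.I / 2 * Complex.I = -(1 / 2) := by
        rw [div_mul_eq_mul_div, Complex.I_mul_I]; ring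
      rw [this]
      module
    have hcan : Eᴴ * slice P x y * E =
        Matrix.diagonal ((1 / 2 : ℂ) • f - (Complex.I / 2) • g) := by
      rw [hs]
      calc _ = (Eᴴ * E) * Matrix.diagonal ((1 / 2 : ℂ) • f - (Complex.I / 2) • g) * (Eᴴ * E) := by
            simp only [mul_assoc]
        _ = _ := by rw [hE, one_mul, mul_one]
    conv_lhs => rw [hs]
    congr 3
    ext j
    simp [hcan]

/-- The dichotomy behind the rigidity of commuting blocks. -/
lemma eq_or_eq_zero_of_proportional {R S N : Matrix a a ℂ} (hR : R.PosSemidef)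
    (hS : S.IsHermitian) (hprop : ∀ x y z w, (R - S) x y * N z w = (R - S) z w * N x y)
    (hNS : N * S = 0) (htr : N.trace = 0) : R = S ∨ N = 0 := by
  by_contra! hcon
  obtain ⟨hRS, hN⟩ := hcon
  obtain ⟨z, w, hzw⟩ : ∃ z w, (R - S) z w ≠ 0 := by
    by_contra! h
    exact hRS (sub_eq_zero.1 (Matrix.ext h))
  have hprop' : N = (N z w / (R - S) z w) • (R - S) := by
    ext x y
    rw [Matrix.smul_apply, smul_eq_mul, div_mul_eq_mul_div, eq_div_iff hzw, mul_comm (N z w),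
      hprop, mul_comm]
  set t := N z w / (R - S) z w
  have ht : t ≠ 0 := by
    intro h
    rw [h, zero_smul] at hprop'
    exact hN hprop'
  have hDS : (R - S) * S = 0 := by
    rw [hprop', Matrix.smul_mul] at hNS
    exact (smul_eq_zero.1 hNS).resolve_left ht
  have hDtr : (R - S).trace = 0 := by
    rw [hprop', Matrix.trace_smul] at htr
    exact (smul_eq_zero.1 htr).resolve_left ht
  have hD : (R - S).IsHermitian := hR.isHermitian.sub hS
  have hSD : S * (R - S) = 0 := by
    have := congrArg Matrix.conjTranspose hDS
    rwa [Matrix.conjTranspose_mul, hD.eq, hS.eq, Matrix.conjTranspose_zero] at this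
  -- An eigenvector of `R - S` with negative eigenvalue is annihilated by `S`, because `S * (R - S)
  -- = 0`. There `R - S` acts as `R ≥ 0`, a contradiction. Positivity and zero trace then give `R =
  -- S`.
  have hpos : (R - S).PosSemidef := by
    rw [hD.posSemidef_iff_eigenvalues_nonneg]
    intro i
    by_contra! hneg
    have hv := hD.mulVec_eigenvectorBasis i
    set v : EuclideanSpace ℂ a := hD.eigenvectorBasis i
    set μ := hD.eigenvalues i
    have hμ : μ < 0 := hneg
    have hSv : S *ᵥ v.ofLp = 0 := by
      have h1 : S *ᵥ ((R - S) *ᵥ v.ofLp) = 0 := by rw [Matrix.mulVec_mulVec, hSD, Matrix.zero_mulVec]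
      rw [hv, Matrix.mulVec_smul] at h1
      exact (smul_eq_zero.1 h1).resolve_left hμ.ne
    rw [Matrix.sub_mulVec, hSv, sub_zero] at hv
    have h2 := hR.dotProduct_mulVec_nonneg v.ofLp
    rw [hv, dotProduct_smul] at h2
    have h3 : star v.ofLp ⬝ᵥ v.ofLp = 1 := by
      have := (orthonormal_iff_ite.1 hD.eigenvectorBasis.orthonormal) i i
      rw [if_pos rfl, PiLp.inner_apply] at this
      rw [← this]
      simp [dotProduct, v, Complex.conj_mul']
    rw [h3] at h2
    have h4 := (Complex.nonneg_iff.1 h2).1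
    simp at h4
    linarith
  exact hRS (sub_eq_zero.1 (hpos.trace_eq_zero_iff.1 hDtr))

/-- If `P` is positive with commuting blocks and `N` annihilates `P`, then infinitesimal
commutativity of the blocks along `N` already forces the blocks of `P` and `N` to commute. -/
lemma slicesCommute_of_swap {P N : Matrix (a × b) (a × b) ℂ} (hP : P.PosSemidef)
    (hc : SlicesCommute P P) (hNP : N * P = 0) {t : ℂ} (htr : traceA N = t • traceA P)
    (hswap : ∀ x y z w, slice P x y * slice N z w - slice N z w * slice P x y =
      slice P z w * slice N x y - slice N x y * slice P z w) : SlicesCommute P N := by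
  obtain ⟨E, R, hE, hE', hR, hPs⟩ := exists_blockDiagonal hP hc
  let n : a → a → Matrix b b ℂ := fun x y => Eᴴ * slice N x y * E
  have hNs (x y : a) : slice N x y = E * n x y * Eᴴ := by
    calc _ = (E * Eᴴ) * slice N x y * (E * Eᴴ) := by rw [hE', one_mul, mul_one]
      _ = _ := by simp only [n, mul_assoc]
  have hmul (A B : Matrix b b ℂ) : E * A * Eᴴ * (E * B * Eᴴ) = E * (A * B) * Eᴴ := by
    calc _ = E * A * (Eᴴ * E) * B * Eᴴ := by simp only [mul_assoc]
      _ = _ := by rw [hE, mul_one]; simp only [mul_assoc]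
  have hinj {A B : Matrix b b ℂ} (h : E * A * Eᴴ = E * B * Eᴴ) : A = B := by
    have h2 (Z : Matrix b b ℂ) : Eᴴ * (E * Z * Eᴴ) * E = Z := by
      calc _ = (Eᴴ * E) * Z * (Eᴴ * E) := by simp only [mul_assoc]
        _ = Z := by rw [hE, one_mul, mul_one]
    rw [← h2 A, h, h2]
  -- In the basis `E`, `P` is a direct sum of the `R j` and `N` has blocks indexed by `(j, k)`. The
  -- swap identity makes such a block proportional to `R j - R k`; `N * P = 0` makes it annihilate
  -- `R k`; off the diagonal its trace vanishes, because `traceA P` is diagonal.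
  have key (j k : b) : R j = R k ∨ (Matrix.of fun x y => n x y j k) = 0 := by
    rcases eq_or_ne j k with rfl | hjk
    · exact Or.inl rfl
    refine eq_or_eq_zero_of_proportional (hR j) (hR k).isHermitian (fun x y z w => ?_) ?_ ?_
    · have h := hswap x y z w
      simp only [hPs, hNs, hmul, ← mul_sub, ← sub_mul] at h
      have h' := congrFun (congrFun (hinj h) j) k
      simp only [Matrix.sub_apply, Matrix.diagonal_mul, Matrix.mul_diagonal] at h'
      simp only [Matrix.sub_apply, Matrix.of_apply]
      linear_combination h'
    · ext x w
      have h : slice (N * P) x w = 0 := by rw [hNP]; rfl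
      rw [slice_mul] at h
      simp only [hPs, hNs, hmul, ← Matrix.mul_sum, ← Matrix.sum_mul] at h
      have h' := congrFun (congrFun (hinj (h.trans (by simp : (0 : Matrix b b ℂ) = E * 0 * Eᴴ))) j) k
      simpa [Matrix.sum_apply, Matrix.mul_apply (M := Matrix.of _)] using h'
    · rw [traceA_eq_sum_slice, traceA_eq_sum_slice] at htr
      have h : E * (∑ x, n x x) * Eᴴ =
          E * (t • ∑ x, Matrix.diagonal fun j => R j x x) * Eᴴ := by
        simp only [Matrix.mul_smul, Matrix.smul_mul, Matrix.mul_sum, Matrix.sum_mul, ← hNs, ← hPs,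
          htr]
      have h' := congrFun (congrFun (hinj h) j) k
      simpa [Matrix.sum_apply, hjk, Matrix.trace] using h'
  intro x y z w
  rw [Commute, SemiconjBy, hPs, hNs, hmul, hmul]
  congr 2
  ext j k
  rw [Matrix.diagonal_mul, Matrix.mul_diagonal]
  rcases key j k with h | h
  · rw [h, mul_comm]
  · have : n z w j k = 0 := congrFun (congrFun h z) w
    rw [this, mul_zero, zero_mul]

end Slices

/-! ### Pure states span all operators -/

section PureStates

variable {c : Type*} [Fintype c] [DecidableEq c]

lemma ketbra_smul (z : ℂ) (v : EuclideanSpace ℂ c) :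
    ketbra (z • v) = (z * star z) • ketbra v := by
  ext i j
  simp [ketbra]
  ring

lemma trace_ketbra (v : EuclideanSpace ℂ c) : (ketbra v).trace = (‖v‖ : ℂ) ^ 2 := by
  rw [← Complex.ofReal_pow, EuclideanSpace.norm_sq_eq, Matrix.trace]
  push_cast
  exact Finset.sum_congr rfl fun i _ => Complex.mul_conj' _

lemma posSemidef_ketbra (v : EuclideanSpace ℂ c) : (ketbra v).PosSemidef :=
  Matrix.posSemidef_vecMulVec_self_star v.ofLp

lemma isState_ketbra {v : EuclideanSpace ℂ c} (hv : ‖v‖ = 1) : IsState (ketbra v) :=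
  ⟨posSemidef_ketbra v, by rw [trace_ketbra, hv]; simp⟩

lemma ketbra_eq_zero_or_eq_smul (v : EuclideanSpace ℂ c) :
    ketbra v = 0 ∨ ∃ t : ℂ, ∃ ρ ∈ pureStates c, ketbra v = t • ρ := by
  rcases eq_or_ne v 0 with rfl | hv
  · refine Or.inl ?_
    ext i j
    simp [ketbra]
  · have hn : ‖v‖ ≠ 0 := norm_ne_zero_iff.2 hv
    refine Or.inr ⟨(‖v‖ : ℂ) * star (‖v‖ : ℂ), _, ⟨(‖v‖ : ℂ)⁻¹ • v, ?_, rfl⟩, ?_⟩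
    · rw [norm_smul, norm_inv, Complex.norm_real, norm_norm, inv_mul_cancel₀ hn]
    · rw [← ketbra_smul, smul_smul, mul_inv_cancel₀ (by exact_mod_cast hn), one_smul]

lemma ketbra_mem_span (v : EuclideanSpace ℂ c) :
    ketbra v ∈ Submodule.span ℂ (pureStates c) := by
  rcases ketbra_eq_zero_or_eq_smul v with h | ⟨t, ρ, hρ, h⟩
  · rw [h]
    exact zero_mem _
  · rw [h]
    exact Submodule.smul_mem _ _ (Submodule.subset_span hρ)

lemma ketbra_single_add (i j : c) (t : ℂ) :
    ketbra (EuclideanSpace.single i (1 : ℂ) + t • EuclideanSpace.single j (1 : ℂ)) =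
      Matrix.single i i 1 + t • Matrix.single j i 1 + star t • Matrix.single i j 1
        + (t * star t) • Matrix.single j j 1 := by
  ext x y
  have hs (z w u v : c) : Matrix.single z w (1 : ℂ) u v =
      (if u = z then 1 else 0) * (if v = w then 1 else 0) := by
    rw [Matrix.single_apply]
    simp only [ite_and, eq_comm (a := z), eq_comm (a := w)]
    split_ifs <;> simp
  simp only [ketbra, Matrix.of_apply, PiLp.add_apply, PiLp.smul_apply, PiLp.single_apply,
    smul_eq_mul, star_add, star_mul', Matrix.add_apply, Matrix.smul_apply, hs, apply_ite star,
    star_one, star_zero]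
  ring

lemma ketbra_single (i : c) :
    ketbra (EuclideanSpace.single i (1 : ℂ)) = Matrix.single i i 1 := by
  have := ketbra_single_add i i 0
  simpa using this

/-- The pure states span the space of operators. -/
lemma span_pureStates : Submodule.span ℂ (pureStates c) = ⊤ := by
  rw [eq_top_iff]
  intro X _
  have hij (i j : c) : Matrix.single i j (1 : ℂ) ∈ Submodule.span ℂ (pureStates c) := by
    have h1 := ketbra_mem_span
      (EuclideanSpace.single i (1 : ℂ) + (1 : ℂ) • EuclideanSpace.single j (1 : ℂ))
    have h2 := ketbra_mem_span
      (EuclideanSpace.single i (1 : ℂ) + Complex.I • EuclideanSpace.single j (1 : ℂ))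
    have h3 := ketbra_mem_span (EuclideanSpace.single i (1 : ℂ))
    have h4 := ketbra_mem_span (EuclideanSpace.single j (1 : ℂ))
    rw [ketbra_single_add] at h1 h2
    rw [ketbra_single] at h3 h4
    have e : Matrix.single i j (1 : ℂ) = (1 / 2 : ℂ) • (Matrix.single i i (1 : ℂ)
        + (1 : ℂ) • Matrix.single j i (1 : ℂ) + star (1 : ℂ) • Matrix.single i j (1 : ℂ)
        + ((1 : ℂ) * star (1 : ℂ)) • Matrix.single j j (1 : ℂ))
        + (Complex.I / 2) • (Matrix.single i i (1 : ℂ)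
        + Complex.I • Matrix.single j i (1 : ℂ) + star Complex.I • Matrix.single i j (1 : ℂ)
        + (Complex.I * star Complex.I) • Matrix.single j j (1 : ℂ))
        - ((1 + Complex.I) / 2) • (Matrix.single i i (1 : ℂ) + Matrix.single j j (1 : ℂ)) := by
      simp only [star_one, RCLike.star_def, Complex.conj_I, mul_neg, Complex.I_mul_I, neg_neg,
        smul_add, smul_smul, neg_smul, smul_neg, div_mul_eq_mul_div, mul_one]
      module
    rw [e]
    exact sub_mem (add_mem (Submodule.smul_mem _ _ h1) (Submodule.smul_mem _ _ h2))
      (Submodule.smul_mem _ _ (add_mem h3 h4))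
  rw [Matrix.matrix_eq_sum_single X]
  refine Submodule.sum_mem _ fun i _ => Submodule.sum_mem _ fun j _ => ?_
  have := Submodule.smul_mem _ (X i j) (hij i j)
  rwa [Matrix.smul_single, smul_eq_mul, mul_one] at this

end PureStates

/-! ### The Knill-Laflamme condition and orthogonality -/

section KnillLaflamme

variable {c n : Type*} [Fintype c] [DecidableEq c] [Fintype n] [DecidableEq n]

lemma sum_conj_apply {r : Type*} [Fintype r] (K : r → Matrix n c ℂ) (X : Matrix c c ℂ) :
    (∑ k, conj (K k)) X = ∑ k, K k * X * (K k)ᴴ := by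
  rw [LinearMap.sum_apply]
  rfl

/-- The Kraus operators of the identity process are multiples of the identity. -/
lemma exists_eq_smul_one_of_sum_conj_eq {r : Type*} [Fintype r] {N : r → Matrix c c ℂ}
    (h : ∀ X, ∑ k, N k * X * (N k)ᴴ = X) (k : r) : ∃ z : ℂ, N k = z • 1 := by
  have he (x y u v : c) : ∑ k, N k u x * star (N k v y) = Matrix.single x y (1 : ℂ) u v := by
    rw [← h (Matrix.single x y 1), Matrix.sum_apply]
    refine Finset.sum_congr rfl fun k _ => ?_
    simp [Matrix.mul_apply, Matrix.single_apply, ite_and]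
  have hz (f : r → ℂ) (hf : ∑ k, f k * star (f k) = 0) (k : r) : f k = 0 := by
    have h1 : ∑ k, Complex.normSq (f k) = 0 := by
      apply Complex.ofReal_injective
      push_cast
      rw [← hf]
      exact Finset.sum_congr rfl fun k _ => (Complex.mul_conj _).symm
    exact Complex.normSq_eq_zero.1
      ((Finset.sum_eq_zero_iff_of_nonneg fun k _ => Complex.normSq_nonneg _).1 h1 k
        (Finset.mem_univ k))
  -- Sums of squared moduli over `k` can be read off from the action on matrix units: they vanish
  -- for off-diagonal entries, and below for differences of diagonal entries.
  have hoff (x y : c) (hxy : x ≠ y) (k : r) : N k x y = 0 :=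
    hz (fun k => N k x y) (by rw [he, Matrix.single_apply, if_neg (by simp [hxy.symm])]) k
  have hdiag (x y : c) (k : r) : N k x x = N k y y := by
    refine sub_eq_zero.1 (hz (fun k => N k x x - N k y y) ?_ k)
    simp only [star_sub, sub_mul, mul_sub, Finset.sum_sub_distrib, he]
    simp
  rcases isEmpty_or_nonempty c with hc | ⟨⟨x⟩⟩
  · exact ⟨0, Subsingleton.elim _ _⟩
  · refine ⟨N k x x, ?_⟩
    ext u v
    rcases eq_or_ne u v with rfl | huv
    · simp [hdiag u x k]
    · simp [huv, hoff u v huv k]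

/-- The Knill-Laflamme condition: the Kraus operators of a reversible process satisfy
`Kᵢ† Kⱼ = Λᵢⱼ`. -/
lemma exists_kraus_of_leftInverse {Φ : Matrix c c ℂ →ₗ[ℂ] Matrix n n ℂ} (hΦ : IsChannel Φ)
    {U : Matrix n n ℂ →ₗ[ℂ] Matrix c c ℂ} (hU : IsChannel U) (h : ∀ X, U (Φ X) = X) :
    ∃ (r : ℕ) (K : Fin r → Matrix n c ℂ) (Λ : Matrix (Fin r) (Fin r) ℂ),
      ∑ k, (K k)ᴴ * K k = 1 ∧ Φ = ∑ k, conj (K k) ∧ ∀ i j, (K i)ᴴ * K j = Λ i j • 1 := by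
  obtain ⟨r, K, hK, rfl⟩ := hΦ
  obtain ⟨q, J, hJ, rfl⟩ := hU
  have hN (X : Matrix c c ℂ) :
      ∑ p : Fin q × Fin r, (J p.1 * K p.2) * X * (J p.1 * K p.2)ᴴ = X := by
    conv_rhs => rw [← h X]
    rw [sum_conj_apply, sum_conj_apply, Fintype.sum_prod_type]
    refine Finset.sum_congr rfl fun j _ => ?_
    rw [Matrix.mul_sum, Matrix.sum_mul]
    refine Finset.sum_congr rfl fun k _ => ?_
    simp only [Matrix.conjTranspose_mul, Matrix.mul_assoc]
  -- The composite with the recovery is the identity process, so each `J j * K k` is a scalar.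
  -- Inserting `∑ (J j)ᴴ * J j = 1` between `(K i)ᴴ` and `K k` then gives a scalar.
  choose z hz using fun p => exists_eq_smul_one_of_sum_conj_eq hN p
  refine ⟨r, K, Matrix.of fun i k => ∑ j, star (z (j, i)) * z (j, k), hK, rfl, fun i k => ?_⟩
  calc (K i)ᴴ * K k = (K i)ᴴ * (∑ j, (J j)ᴴ * J j) * K k := by rw [hJ, Matrix.mul_one]
    _ = ∑ j, (J j * K i)ᴴ * (J j * K k) := by
        rw [Matrix.mul_sum, Matrix.sum_mul]
        refine Finset.sum_congr rfl fun j _ => ?_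
        simp only [Matrix.conjTranspose_mul, Matrix.mul_assoc]
    _ = ∑ j, (star (z (j, i)) * z (j, k)) • (1 : Matrix c c ℂ) := by
        refine Finset.sum_congr rfl fun j _ => ?_
        rw [hz (j, i), hz (j, k), Matrix.conjTranspose_smul, Matrix.conjTranspose_one,
          Matrix.smul_mul, Matrix.mul_smul, smul_smul, one_mul]
    _ = _ := by rw [← Finset.sum_smul, Matrix.of_apply]

variable {r : ℕ} {K : Fin r → Matrix n c ℂ} {Λ : Matrix (Fin r) (Fin r) ℂ}

/-- The inner product `(K i)ᴴ * K j` is scalar and moves out, so a product of two outputs depends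
only on `X * Y`. -/
lemma sum_conj_mul_sum_conj (h : ∀ i j, (K i)ᴴ * K j = Λ i j • 1) (X Y : Matrix c c ℂ) :
    (∑ k, conj (K k)) X * (∑ k, conj (K k)) Y =
      ∑ i, ∑ j, Λ i j • (K i * (X * Y) * (K j)ᴴ) := by
  rw [sum_conj_apply, sum_conj_apply, Finset.sum_mul]
  refine Finset.sum_congr rfl fun i _ => ?_
  rw [Finset.mul_sum]
  refine Finset.sum_congr rfl fun j _ => ?_
  calc _ = K i * X * ((K i)ᴴ * K j) * Y * (K j)ᴴ := by simp only [Matrix.mul_assoc]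
    _ = _ := by
      rw [h]
      simp only [Matrix.mul_smul, Matrix.smul_mul, Matrix.mul_one, Matrix.mul_assoc]

/-- Compressing the vanishing product by `(K l)ᴴ` and `K m` gives `Λ³ l m • (X * Y) = 0`. If `X * Y
≠ 0`, the Hermitian matrix `Λ` is nilpotent, hence zero, against trace preservation. -/
lemma mul_eq_zero_of_sum_conj_mul_eq_zero [Nonempty c] (hK : ∑ k, (K k)ᴴ * K k = 1)
    (h : ∀ i j, (K i)ᴴ * K j = Λ i j • 1) {X Y : Matrix c c ℂ}
    (hXY : (∑ k, conj (K k)) X * (∑ k, conj (K k)) Y = 0) : X * Y = 0 := by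
  by_contra hne
  rw [sum_conj_mul_sum_conj h] at hXY
  have hΛ : Λ * Λ * Λ = 0 := by
    ext l m
    have h1 : (K l)ᴴ * (∑ i, ∑ j, Λ i j • (K i * (X * Y) * (K j)ᴴ)) * K m = 0 := by
      rw [hXY, Matrix.mul_zero, Matrix.zero_mul]
    have h2 : (K l)ᴴ * (∑ i, ∑ j, Λ i j • (K i * (X * Y) * (K j)ᴴ)) * K m
        = (Λ * Λ * Λ) l m • (X * Y) := by
      simp only [Matrix.mul_sum, Matrix.sum_mul, Matrix.mul_apply, Finset.sum_mul,
        Finset.sum_smul]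
      rw [Finset.sum_comm]
      refine Finset.sum_congr rfl fun j _ => Finset.sum_congr rfl fun i _ => ?_
      calc _ = Λ i j • (((K l)ᴴ * K i) * (X * Y) * ((K j)ᴴ * K m)) := by
            simp only [Matrix.mul_smul, Matrix.smul_mul, Matrix.mul_assoc]
        _ = _ := by
            rw [h, h]
            simp only [Matrix.mul_smul, Matrix.smul_mul, Matrix.mul_one, Matrix.one_mul, smul_smul]
            congr 1
            ring
    rw [h2] at h1
    exact (smul_eq_zero.1 h1).resolve_right hne
  have hherm : Λᴴ = Λ := by
    ext i j
    obtain ⟨x⟩ := ‹Nonempty c›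
    have h1 := congrArg Matrix.conjTranspose (h j i)
    rw [Matrix.conjTranspose_mul, Matrix.conjTranspose_conjTranspose, h,
      Matrix.conjTranspose_smul, Matrix.conjTranspose_one] at h1
    have := congrFun (congrFun h1 x) x
    simpa using this.symm
  have h2 : Λ * Λ = 0 := by
    rw [← Matrix.conjTranspose_mul_self_eq_zero, Matrix.conjTranspose_mul, hherm, ← mul_assoc, hΛ,
      zero_mul]
  have h3 : Λ = 0 := by
    rw [← Matrix.conjTranspose_mul_self_eq_zero, hherm, h2]
  simp only [h, h3, Matrix.zero_apply, zero_smul, Finset.sum_const_zero] at hK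
  exact zero_ne_one hK

end KnillLaflamme

/-! ### Polarization of block commutativity -/

section Commuting

variable {a b c : Type*} [Fintype a] [DecidableEq a] [Fintype b] [DecidableEq b]
  [Fintype c] [DecidableEq c]

lemma slice_add (P N : Matrix (a × b) (a × b) ℂ) (x y : a) :
    slice (P + N) x y = slice P x y + slice N x y := rfl

lemma slice_smul (t : ℂ) (P : Matrix (a × b) (a × b) ℂ) (x y : a) :
    slice (t • P) x y = t • slice P x y := rfl

lemma SlicesCommute.symm {P N : Matrix (a × b) (a × b) ℂ} (h : SlicesCommute P N) :
    SlicesCommute N P := fun x y z w => (h z w x y).symm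

lemma SlicesCommute.add_right {P N N' : Matrix (a × b) (a × b) ℂ} (h : SlicesCommute P N)
    (h' : SlicesCommute P N') : SlicesCommute P (N + N') := fun x y z w => by
  rw [slice_add]
  exact (h x y z w).add_right (h' x y z w)

lemma SlicesCommute.smul_right {P N : Matrix (a × b) (a × b) ℂ} (h : SlicesCommute P N) (t : ℂ) :
    SlicesCommute P (t • N) := fun x y z w => by
  rw [slice_smul]
  exact (h x y z w).smul_right t

lemma SlicesCommute.conjTranspose {P N : Matrix (a × b) (a × b) ℂ} (h : SlicesCommute P N) :
    SlicesCommute Pᴴ Nᴴ := fun x y z w => by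
  rw [slice_conjTranspose, slice_conjTranspose]
  have := congrArg Matrix.conjTranspose (h y x w z).eq
  rw [Matrix.conjTranspose_mul, Matrix.conjTranspose_mul] at this
  exact this.symm

/-- Each block is a combination of the `T i`. Terms of weight zero are exempt because the equality
case for separable states says nothing about them. -/
lemma slicesCommute_sum_kronecker {k : Type*} [Fintype k] {p : k → ℂ} {A : k → Matrix a a ℂ}
    {T : k → Matrix b b ℂ} (h : ∀ i j, p i ≠ 0 → p j ≠ 0 → Commute (T i) (T j)) :
    SlicesCommute (∑ i, p i • (A i ⊗ₖ T i)) (∑ i, p i • (A i ⊗ₖ T i)) := by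
  have hs (x y : a) : slice (∑ i, p i • (A i ⊗ₖ T i)) x y = ∑ i, (p i * A i x y) • T i := by
    ext u v
    simp [slice, Matrix.sum_apply, mul_assoc]
  intro x y z w
  rw [hs, hs]
  refine Commute.sum_left _ _ _ fun i _ => Commute.sum_right _ _ _ fun j _ => ?_
  by_cases hi : p i = 0
  · simp [hi]
  by_cases hj : p j = 0
  · simp [hj]
  exact ((h i j hi hj).smul_left _).smul_right _

lemma swapSystems_sum_kronecker {k : Type*} [Fintype k] (p : k → ℂ) (A : k → Matrix a a ℂ)
    (T : k → Matrix b b ℂ) :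
    swapSystems (∑ i, p i • (A i ⊗ₖ T i)) = ∑ i, p i • (T i ⊗ₖ A i) := by
  ext i j
  simp only [swapSystems, Matrix.submatrix_apply, Matrix.sum_apply, Matrix.smul_apply,
    Matrix.kroneckerMap_apply, Prod.fst_swap, Prod.snd_swap]
  exact Finset.sum_congr rfl fun _ _ => by rw [mul_comm (A _ _ _)]

lemma ketbra_mul_ketbra (v w : EuclideanSpace ℂ c) :
    ketbra v * ketbra w = inner ℂ v w • Matrix.of fun i j => v i * star (w j) := by
  ext i j
  simp only [ketbra, Matrix.mul_apply, Matrix.of_apply, Matrix.smul_apply, smul_eq_mul,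
    PiLp.inner_apply, Finset.sum_mul]
  refine Finset.sum_congr rfl fun x _ => ?_
  simp
  ring

lemma commute_ketbra_of_inner_eq_zero {v w : EuclideanSpace ℂ c} (h : inner ℂ v w = 0) :
    Commute (ketbra v) (ketbra w) := by
  rw [Commute, SemiconjBy, ketbra_mul_ketbra, ketbra_mul_ketbra, h, inner_eq_zero_symm.1 h,
    zero_smul, zero_smul]

lemma commute_ketbra_of_norm_inner_eq_one {v w : EuclideanSpace ℂ c} (hv : ‖v‖ = 1)
    (hw : ‖w‖ = 1) (h : ‖inner ℂ v w‖ = 1) : Commute (ketbra v) (ketbra w) := by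
  obtain ⟨t, -, rfl⟩ := ((norm_inner_div_norm_mul_norm_eq_one_iff (𝕜 := ℂ) v w).1
    (by rw [hv, hw]; simpa using h)).2
  rw [ketbra_smul]
  exact (Commute.refl _).smul_right _

lemma commute_ketbra_basis {ι : Type*} [Fintype ι] (e : OrthonormalBasis ι ℂ (EuclideanSpace ℂ c))
    (i j : ι) : Commute (ketbra (e i)) (ketbra (e j)) := by
  rcases eq_or_ne i j with rfl | h
  · exact Commute.refl _
  · exact commute_ketbra_of_inner_eq_zero (e.orthonormal.2 h)

lemma IsQuantumClassical.slicesCommute {X : Matrix (a × b) (a × b) ℂ} (h : IsQuantumClassical X) :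
    SlicesCommute X X := by
  obtain ⟨e, p, σ, -, -, -, rfl⟩ := h
  exact slicesCommute_sum_kronecker fun i j _ _ => commute_ketbra_basis e i j

lemma IsClassicallyCorrelated.slicesCommute {X : Matrix (a × b) (a × b) ℂ}
    (h : IsClassicallyCorrelated X) :
    SlicesCommute X X ∧ SlicesCommute (swapSystems X) (swapSystems X) := by
  obtain ⟨f, e, p, -, -, rfl⟩ := h
  rw [← Fintype.sum_prod_type' fun i j => (p i j : ℂ) • (ketbra (f i) ⊗ₖ ketbra (e j))]
  refine ⟨slicesCommute_sum_kronecker fun i j _ _ => commute_ketbra_basis e i.2 j.2, ?_⟩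
  rw [swapSystems_sum_kronecker]
  exact slicesCommute_sum_kronecker fun i j _ _ => commute_ketbra_basis f i.1 j.1

/-- A linear map that preserves positivity and orthogonality and whose second marginal hides its
input. -/
structure IsOrthogonalHiding (Φ : Matrix c c ℂ →ₗ[ℂ] Matrix (a × b) (a × b) ℂ)
    (ρB : Matrix b b ℂ) : Prop where
  posSemidef : ∀ X, X.PosSemidef → (Φ X).PosSemidef
  map_conjTranspose : ∀ X, Φ Xᴴ = (Φ X)ᴴ
  mul_eq_zero : ∀ X Y, X * Y = 0 → Φ X * Φ Y = 0
  marginal : ∀ X, traceA (Φ X) = X.trace • ρB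

variable {Φ : Matrix c c ℂ →ₗ[ℂ] Matrix (a × b) (a × b) ℂ} {ρB : Matrix b b ℂ}

lemma IsOrthogonalHiding.slicesCommute (h : IsOrthogonalHiding Φ ρB) {P X : Matrix c c ℂ}
    (hP : IsState P) (hc : SlicesCommute (Φ P) (Φ P)) (hXP : X * P = 0)
    (hswap : ∀ x y z w, slice (Φ P) x y * slice (Φ X) z w - slice (Φ X) z w * slice (Φ P) x y =
      slice (Φ P) z w * slice (Φ X) x y - slice (Φ X) x y * slice (Φ P) z w) :
    SlicesCommute (Φ P) (Φ X) :=
  slicesCommute_of_swap (h.posSemidef P hP.posSemidef) hc (h.mul_eq_zero X P hXP) (t := X.trace)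
    (by rw [h.marginal, h.marginal, hP.trace_eq_one, one_smul]) hswap

/-- Polarization of commutativity over all states. -/
lemma slice_swap_of_isState (hc : ∀ ρ, IsState ρ → SlicesCommute (Φ ρ) (Φ ρ)) {P : Matrix c c ℂ}
    (hP : IsState P) (X : Matrix c c ℂ) (x y z w : a) :
    slice (Φ P) x y * slice (Φ X) z w - slice (Φ X) z w * slice (Φ P) x y =
      slice (Φ P) z w * slice (Φ X) x y - slice (Φ X) x y * slice (Φ P) z w := by
  have hX : X ∈ Submodule.span ℂ (pureStates c) := by rw [span_pureStates]; trivial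
  induction hX using Submodule.span_induction with
  | mem σ hσ =>
    obtain ⟨ψ, hψ, rfl⟩ := hσ
    have hσ := isState_ketbra hψ
    -- The equal mixture isolates the cross terms between `P` and `ketbra ψ`. The resulting identity
    -- is linear in the second argument and so extends to the span of pure states.
    have hmix : IsState ((1 / 2 : ℂ) • (P + ketbra ψ)) := by
      refine ⟨(hP.posSemidef.add hσ.posSemidef).smul (by positivity), ?_⟩
      rw [Matrix.trace_smul, Matrix.trace_add, hP.trace_eq_one, hσ.trace_eq_one]
      norm_num
    have h1 := (hc _ hmix x y z w).eq
    have h2 := (hc _ hP x y z w).eq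
    have h3 := (hc _ hσ x y z w).eq
    simp only [map_smul, map_add, slice_smul, slice_add, Matrix.smul_mul, Matrix.mul_smul] at h1
    have h4 := smul_right_injective _ (by norm_num : (1 / 2 : ℂ) ≠ 0) h1
    have h5 := smul_right_injective _ (by norm_num : (1 / 2 : ℂ) ≠ 0) h4
    simp only [add_mul, mul_add, h2, h3] at h5
    rw [sub_eq_sub_iff_add_eq_add]
    have h6 : slice (Φ P) x y * slice (Φ (ketbra ψ)) z w +
        slice (Φ (ketbra ψ)) x y * slice (Φ P) z w =
        slice (Φ P) z w * slice (Φ (ketbra ψ)) x y +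
        slice (Φ (ketbra ψ)) z w * slice (Φ P) x y := by
      have := congrArg (fun Z => Z - slice (Φ P) z w * slice (Φ P) x y -
        slice (Φ (ketbra ψ)) z w * slice (Φ (ketbra ψ)) x y) h5
      abel_nf at this ⊢
      exact this
    rw [h6]
  | zero =>
    have h0 (x y : a) : slice (Φ 0) x y = 0 := by rw [map_zero]; rfl
    simp only [h0, mul_zero, zero_mul]
  | add X Y _ _ hX hY =>
    simp only [map_add, slice_add, mul_add, add_mul]
    rw [add_sub_add_comm, hX, hY, add_sub_add_comm]
  | smul t X _ hX =>
    simp only [map_smul, slice_smul, Matrix.smul_mul, Matrix.mul_smul, ← smul_sub]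
    rw [hX]

/-- If every output state has commuting blocks then the blocks of all outputs commute jointly. -/
lemma IsOrthogonalHiding.slicesCommute_all (h : IsOrthogonalHiding Φ ρB)
    (hc : ∀ ρ, IsState ρ → SlicesCommute (Φ ρ) (Φ ρ)) (X Y : Matrix c c ℂ) :
    SlicesCommute (Φ X) (Φ Y) := by
  have hpure (ψ : EuclideanSpace ℂ c) (hψ : ‖ψ‖ = 1) (Y : Matrix c c ℂ) :
      SlicesCommute (Φ (ketbra ψ)) (Φ Y) := by
    have hP := isState_ketbra hψ
    set P := ketbra ψ with hPdef
    have hPH : Pᴴ = P := hP.posSemidef.isHermitian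
    have hPP : P * P = P := by
      rw [hPdef, ketbra_mul_ketbra, inner_self_eq_norm_sq_to_K, hψ]
      simp [ketbra]
    have hann (Z : Matrix c c ℂ) (hZ : Z * P = 0) : SlicesCommute (Φ P) (Φ Z) :=
      h.slicesCommute hP (hc P hP) hZ (slice_swap_of_isState hc hP Z)
    have hann' (Z : Matrix c c ℂ) (hZ : P * Z = 0) : SlicesCommute (Φ P) (Φ Z) := by
      have := (hann Zᴴ (by rw [← hPH, ← Matrix.conjTranspose_mul, hZ,
        Matrix.conjTranspose_zero])).conjTranspose
      rwa [h.map_conjTranspose, Matrix.conjTranspose_conjTranspose, ← h.map_conjTranspose,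
        hPH] at this
    obtain ⟨t, ht⟩ : ∃ t : ℂ, P * Y * P = t • P := by
      refine ⟨∑ i, ∑ j, star (ψ i) * Y i j * ψ j, ?_⟩
      ext x y
      simp only [hPdef, ketbra, Matrix.mul_apply, Matrix.of_apply, Matrix.smul_apply, smul_eq_mul,
        Finset.sum_mul]
      rw [Finset.sum_comm]
      exact Finset.sum_congr rfl fun i _ => Finset.sum_congr rfl fun j _ => by ring
    -- The first summand is killed by `P` on the right and the second by `P` on the left, which the
    -- adjoint reduces to the first case; the third is a multiple of `P`.
    have hY : Y = (Y - Y * P) + (Y * P - P * Y * P) + t • P := by rw [← ht]; abel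
    rw [hY, map_add, map_add, map_smul]
    refine ((hann _ ?_).add_right (hann' _ ?_)).add_right ((hc P hP).smul_right t)
    · rw [sub_mul, mul_assoc, hPP, sub_self]
    · rw [mul_sub, ← mul_assoc, ← mul_assoc, ← mul_assoc, hPP, sub_self]
  have hX : X ∈ Submodule.span ℂ (pureStates c) := by rw [span_pureStates]; trivial
  refine SlicesCommute.symm ?_
  induction hX using Submodule.span_induction with
  | mem σ hσ =>
    obtain ⟨ψ, hψ, rfl⟩ := hσ
    exact (hpure ψ hψ Y).symm
  | zero =>
    rw [map_zero]
    exact fun x y z w => Commute.zero_right _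
  | add X X' _ _ hX hX' =>
    rw [map_add]
    exact hX.add_right hX'
  | smul t X _ hX =>
    rw [map_smul]
    exact hX.smul_right t

/-- Extraction of the coefficient of `star t` from an identity of degree at most two in `t` and in
`star t`. -/
lemma coeff_star_eq_zero {C0 C1 C2 C3 C4 C5 C6 C7 C8 : ℂ}
    (h : ∀ t : ℂ, C0 + t * C1 + star t * C2 + t * star t * C3 + t ^ 2 * C4 + star t ^ 2 * C5
      + t ^ 2 * star t * C6 + t * star t ^ 2 * C7 + t ^ 2 * star t ^ 2 * C8 = 0) : C2 = 0 := by
  have hI := Complex.I_sq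
  have e1 := h 1
  have e2 := h (-1)
  have e3 := h Complex.I
  have e4 := h (-Complex.I)
  have f1 := h 2
  have f2 := h (-2)
  have f3 := h (2 * Complex.I)
  have f4 := h (-(2 * Complex.I))
  simp only [star_one, star_neg, star_mul', RCLike.star_def, Complex.conj_I, map_ofNat]
    at e1 e2 e3 e4 f1 f2 f3 f4
  -- Averaging over fourth roots of unity keeps only the terms of net degree -1 modulo 4, namely
  -- `C2` and `C7`; comparing radii 1 and 2 eliminates `C7`.
  linear_combination (norm := (ring_nf; simp only [hI]; ring))
    (1 / 3) * (e1 - e2 + Complex.I * e3 - Complex.I * e4)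
      - (1 / 24) * (f1 - f2 + Complex.I * f3 - Complex.I * f4)

/-- Polarization of commutativity over the pure states. -/
lemma slice_swap_of_pure (hc : ∀ ρ ∈ pureStates c, SlicesCommute (Φ ρ) (Φ ρ)) (i j : c)
    (x y z w : a) :
    slice (Φ (Matrix.single i i 1)) x y * slice (Φ (Matrix.single i j 1)) z w
        - slice (Φ (Matrix.single i j 1)) z w * slice (Φ (Matrix.single i i 1)) x y =
      slice (Φ (Matrix.single i i 1)) z w * slice (Φ (Matrix.single i j 1)) x y
        - slice (Φ (Matrix.single i j 1)) x y * slice (Φ (Matrix.single i i 1)) z w := by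
  have hv (v : EuclideanSpace ℂ c) : SlicesCommute (Φ (ketbra v)) (Φ (ketbra v)) := by
    rcases ketbra_eq_zero_or_eq_smul v with h | ⟨t, ρ, hρ, h⟩
    · rw [h, map_zero]
      exact fun x y z w => Commute.zero_right _
    · rw [h, map_smul]
      exact (((hc ρ hρ).smul_right t).symm).smul_right t
  have ht (t : ℂ) := (hv (EuclideanSpace.single i (1 : ℂ)
    + t • EuclideanSpace.single j (1 : ℂ)) x y z w).eq
  simp only [ketbra_single_add, map_add, map_smul, slice_add, slice_smul] at ht
  generalize slice (Φ (Matrix.single i i 1)) x y = p00 at *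
  generalize slice (Φ (Matrix.single j i 1)) x y = p10 at *
  generalize slice (Φ (Matrix.single i j 1)) x y = p01 at *
  generalize slice (Φ (Matrix.single j j 1)) x y = p11 at *
  generalize slice (Φ (Matrix.single i i 1)) z w = q00 at *
  generalize slice (Φ (Matrix.single j i 1)) z w = q10 at *
  generalize slice (Φ (Matrix.single i j 1)) z w = q01 at *
  generalize slice (Φ (Matrix.single j j 1)) z w = q11 at *
  simp only [add_mul, mul_add, Matrix.smul_mul, Matrix.mul_smul] at ht
  ext u v
  -- Mixtures are not available here, so the vectors eᵢ + t eⱼ replace them. The coefficient `C2` is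
  -- the one pairing |i⟩⟨i| with |i⟩⟨j|.
  have key := coeff_star_eq_zero (C0 := (p00 * q00 - q00 * p00) u v)
    (C1 := (p00 * q10 - q10 * p00 + (p10 * q00 - q00 * p10)) u v)
    (C2 := (p00 * q01 - q01 * p00 + (p01 * q00 - q00 * p01)) u v)
    (C3 := (p00 * q11 - q11 * p00 + (p11 * q00 - q00 * p11)
      + (p10 * q01 - q01 * p10 + (p01 * q10 - q10 * p01))) u v)
    (C4 := (p10 * q10 - q10 * p10) u v) (C5 := (p01 * q01 - q01 * p01) u v)
    (C6 := (p10 * q11 - q11 * p10 + (p11 * q10 - q10 * p11)) u v)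
    (C7 := (p01 * q11 - q11 * p01 + (p11 * q01 - q01 * p11)) u v)
    (C8 := (p11 * q11 - q11 * p11) u v) fun t => by
      have := congrFun (congrFun (ht t) u) v
      simp only [Matrix.add_apply, Matrix.smul_apply, smul_eq_mul] at this
      simp only [Matrix.add_apply, Matrix.sub_apply]
      linear_combination this
  simp only [Matrix.add_apply, Matrix.sub_apply] at key ⊢
  linear_combination key

/-- If all pure outputs have commuting blocks on both sides, then the outputs of `|i⟩⟨i|` and
`|i⟩⟨j|` multiply to zero. -/
lemma IsOrthogonalHiding.mul_eq_zero_of_pure {ρA : Matrix a a ℂ} (h : IsOrthogonalHiding Φ ρB)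
    {Ψ : Matrix c c ℂ →ₗ[ℂ] Matrix (b × a) (b × a) ℂ} (hΨ : ∀ X, Ψ X = swapSystems (Φ X))
    (h' : IsOrthogonalHiding Ψ ρA)
    (hc : ∀ ρ ∈ pureStates c, SlicesCommute (Φ ρ) (Φ ρ) ∧
      SlicesCommute (swapSystems (Φ ρ)) (swapSystems (Φ ρ))) {i j : c} (hij : i ≠ j) :
    Φ (Matrix.single i i 1) * Φ (Matrix.single i j 1) = 0 := by
  have hmem : Matrix.single i i (1 : ℂ) ∈ pureStates c :=
    ⟨EuclideanSpace.single i 1, by simp, (ketbra_single i).symm⟩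
  have hst : IsState (Matrix.single i i (1 : ℂ)) := by
    rw [← ketbra_single]
    exact isState_ketbra (by simp)
  have hz : Matrix.single i j (1 : ℂ) * Matrix.single i i 1 = 0 :=
    Matrix.single_mul_single_of_ne (h := hij.symm) ..
  have hc' : ∀ ρ ∈ pureStates c, SlicesCommute (Ψ ρ) (Ψ ρ) := fun ρ hρ => by
    rw [hΨ]; exact (hc ρ hρ).2
  have h1 := h.slicesCommute hst (hc _ hmem).1 hz
    (slice_swap_of_pure (fun ρ hρ => (hc ρ hρ).1) i j)
  have h2 := h'.slicesCommute hst (hc' _ hmem) hz (slice_swap_of_pure hc' i j)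
  rw [hΨ, hΨ] at h2
  rw [h1.mul_eq_mul h2, h.mul_eq_zero _ _ hz]

end Commuting

/-! ### Universal maskers and purified safe states -/

section Maskers

variable {a b c s : Type*} [Fintype a] [DecidableEq a] [Fintype b] [DecidableEq b]
  [Fintype c] [DecidableEq c] [Fintype s] [DecidableEq s]

lemma traceA_eq_trace_smul {Φ : Matrix c c ℂ →ₗ[ℂ] Matrix (a × b) (a × b) ℂ} {ρB : Matrix b b ℂ}
    (h : ∀ ρ ∈ pureStates c, traceA (Φ ρ) = ρB) (X : Matrix c c ℂ) :
    traceA (Φ X) = X.trace • ρB := by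
  have hX : X ∈ Submodule.span ℂ (pureStates c) := by rw [span_pureStates]; trivial
  induction hX using Submodule.span_induction with
  | mem σ hσ =>
    rw [h σ hσ]
    obtain ⟨ψ, hψ, rfl⟩ := hσ
    rw [(isState_ketbra hψ).trace_eq_one, one_smul]
  | zero =>
    ext u v
    simp [traceA]
  | add X Y _ _ hX hY =>
    rw [map_add, Matrix.trace_add, add_smul, ← hX, ← hY]
    ext u v
    simp [traceA, Finset.sum_add_distrib]
  | smul t X _ hX =>
    rw [map_smul, IsMaskingTensor.traceA_smul, hX, Matrix.trace_smul, smul_smul, smul_eq_mul]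

/-- The process `Φ` followed by the exchange of the output systems. -/
def swapOutput (Φ : Matrix c c ℂ →ₗ[ℂ] Matrix (a × b) (a × b) ℂ) :
    Matrix c c ℂ →ₗ[ℂ] Matrix (b × a) (b × a) ℂ where
  toFun X := swapSystems (Φ X)
  map_add' X Y := by rw [map_add]; rfl
  map_smul' t X := by rw [map_smul]; rfl

lemma traceB_eq_trace_smul {Φ : Matrix c c ℂ →ₗ[ℂ] Matrix (a × b) (a × b) ℂ} {ρA : Matrix a a ℂ}
    (h : ∀ ρ ∈ pureStates c, traceB (Φ ρ) = ρA) (X : Matrix c c ℂ) :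
    traceB (Φ X) = X.trace • ρA :=
  traceA_eq_trace_smul (Φ := swapOutput Φ) h X

lemma IsOrthogonalHiding.swapOutput {Φ : Matrix c c ℂ →ₗ[ℂ] Matrix (a × b) (a × b) ℂ}
    {ρA : Matrix a a ℂ} {ρB : Matrix b b ℂ} (h : IsOrthogonalHiding Φ ρB)
    (hA : ∀ X, traceB (Φ X) = X.trace • ρA) : IsOrthogonalHiding (swapOutput Φ) ρA where
  posSemidef X hX := (h.posSemidef X hX).submatrix _
  map_conjTranspose X := by
    change swapSystems (Φ Xᴴ) = _
    rw [h.map_conjTranspose]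
    rfl
  mul_eq_zero X Y hXY := by
    change swapSystems (Φ X) * swapSystems (Φ Y) = 0
    rw [swapSystems, swapSystems]
    rw [show (Prod.swap : b × a → a × b) = Equiv.prodComm b a from rfl,
      Matrix.submatrix_mul_equiv, h.mul_eq_zero X Y hXY]
    rfl
  marginal X := hA X

/-- A universal masker hides its input in both marginals and preserves and reflects
orthogonality. -/
lemma IsUniversalMasker.exists_hiding [Nonempty c]
    {Φ : Matrix c c ℂ →ₗ[ℂ] Matrix (a × b) (a × b) ℂ} (h : IsUniversalMasker Φ) :
    ∃ (ρA : Matrix a a ℂ) (ρB : Matrix b b ℂ), (∀ X, traceB (Φ X) = X.trace • ρA) ∧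
      IsOrthogonalHiding Φ ρB ∧ ∀ X Y, Φ X * Φ Y = 0 → X * Y = 0 := by
  have hpure {ρ : Matrix c c ℂ} (hρ : ρ ∈ pureStates c) : IsState ρ := by
    obtain ⟨ψ, hψ, rfl⟩ := hρ
    exact isState_ketbra hψ
  obtain ⟨ρA, hA⟩ := h.marginalA
  obtain ⟨ρB, hB⟩ := h.marginalB
  obtain ⟨U, hU, hUΦ⟩ := h.unmask
  have hinv (X : Matrix c c ℂ) : U (Φ X) = X := by
    have : U ∘ₗ Φ = LinearMap.id := by
      refine LinearMap.ext_on span_pureStates fun ρ hρ => ?_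
      exact hUΦ ρ (hpure hρ)
    exact LinearMap.congr_fun this X
  obtain ⟨r, K, Λ, hK, rfl, hΛ⟩ := exists_kraus_of_leftInverse h.isChannel hU hinv
  refine ⟨ρA, ρB, traceB_eq_trace_smul fun ρ hρ => hA ρ (hpure hρ), ⟨?_, ?_, ?_,
    traceA_eq_trace_smul fun ρ hρ => hB ρ (hpure hρ)⟩,
    fun X Y => mul_eq_zero_of_sum_conj_mul_eq_zero hK hΛ⟩
  · intro X hX
    rw [sum_conj_apply]
    exact Matrix.posSemidef_sum _ fun k _ => hX.mul_mul_conjTranspose_same _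
  · intro X
    rw [sum_conj_apply, sum_conj_apply, Matrix.conjTranspose_sum]
    refine Finset.sum_congr rfl fun k _ => ?_
    simp only [Matrix.conjTranspose_mul, Matrix.conjTranspose_conjTranspose, Matrix.mul_assoc]
  · intro X Y hXY
    rw [sum_conj_mul_sum_conj hΛ, hXY]
    simp

/-- Pure outputs of a universal masker cannot all have commuting blocks on both sides. -/
lemma IsUniversalMasker.not_pure_slicesCommute [Nontrivial c]
    {Φ : Matrix c c ℂ →ₗ[ℂ] Matrix (a × b) (a × b) ℂ} (h : IsUniversalMasker Φ)
    (hc : ∀ ρ ∈ pureStates c, SlicesCommute (Φ ρ) (Φ ρ) ∧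
      SlicesCommute (swapSystems (Φ ρ)) (swapSystems (Φ ρ))) : False := by
  obtain ⟨i, j, hij⟩ := exists_pair_ne c
  obtain ⟨ρA, ρB, hA, hΦ, hne⟩ := h.exists_hiding
  have h0 := hΦ.mul_eq_zero_of_pure (Ψ := swapOutput Φ) (fun X => rfl) (hΦ.swapOutput hA) hc hij
  have := congrFun (congrFun (hne _ _ h0) i) j
  simp at this

lemma exists_mul_conjTranspose {n : Type*} [Fintype n] {ω : Matrix n n ℂ} (h : ω.PosSemidef) :
    ∃ (m : ℕ) (Q : Matrix n (Fin m) ℂ), ω = Q * Qᴴ := by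
  obtain ⟨m, v, hv⟩ := Matrix.posSemidef_iff_eq_sum_vecMulVec.1 h
  refine ⟨m, Matrix.of fun i j => v j i, ?_⟩
  rw [hv]
  ext i j
  simp [Matrix.sum_apply, Matrix.mul_apply, Matrix.vecMulVec_apply]

/-- With `ω = Q * Qᴴ`, take `L = M * (1 ⊗ₖ Q)` and `κ = Qᴴ * Q`, which has the nonzero spectrum of
`ω`. -/
lemma exists_isMaskingTensor {M : Matrix (a × b) (c × s) ℂ} (hM : Mᴴ * M = 1) {ω : Matrix s s ℂ}
    (hω : IsState ω) {ρA : Matrix a a ℂ} {ρB : Matrix b b ℂ}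
    (hA : ∀ X : Matrix c c ℂ, traceB (M * (X ⊗ₖ ω) * Mᴴ) = X.trace • ρA)
    (hB : ∀ X : Matrix c c ℂ, traceA (M * (X ⊗ₖ ω) * Mᴴ) = X.trace • ρB) :
    ∃ (m : ℕ) (L : Matrix (a × b) (c × Fin m) ℂ) (κ : Matrix (Fin m) (Fin m) ℂ),
      IsMaskingTensor L κ ρA ρB ∧
      (∀ X : Matrix c c ℂ, M * (X ⊗ₖ ω) * Mᴴ = L * (X ⊗ₖ (1 : Matrix (Fin m) (Fin m) ℂ)) * Lᴴ) ∧
      spectralSum Real.negMulLog κ = spectralSum Real.negMulLog ω := by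
  obtain ⟨m, Q, hQ⟩ := exists_mul_conjTranspose hω.posSemidef
  have hL (X : Matrix c c ℂ) : M * (X ⊗ₖ ω) * Mᴴ =
      (M * ((1 : Matrix c c ℂ) ⊗ₖ Q)) * (X ⊗ₖ (1 : Matrix (Fin m) (Fin m) ℂ)) *
        (M * ((1 : Matrix c c ℂ) ⊗ₖ Q))ᴴ := by
    have : X ⊗ₖ ω = ((1 : Matrix c c ℂ) ⊗ₖ Q) * (X ⊗ₖ (1 : Matrix (Fin m) (Fin m) ℂ)) *
        ((1 : Matrix c c ℂ) ⊗ₖ Q)ᴴ := by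
      rw [Matrix.conjTranspose_kronecker, ← Matrix.mul_kronecker_mul, ← Matrix.mul_kronecker_mul,
        Matrix.conjTranspose_one, Matrix.mul_one, Matrix.mul_one, Matrix.one_mul, ← hQ]
    rw [this, Matrix.conjTranspose_mul]
    simp only [Matrix.mul_assoc]
  refine ⟨m, M * ((1 : Matrix c c ℂ) ⊗ₖ Q), Qᴴ * Q, ⟨⟨?_, ?_⟩, ?_, ?_, ?_⟩, hL, ?_⟩
  · exact Matrix.posSemidef_conjTranspose_mul_self Q
  · rw [Matrix.trace_mul_comm, ← hQ, hω.trace_eq_one]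
  · calc _ = ((1 : Matrix c c ℂ) ⊗ₖ Q)ᴴ * (Mᴴ * M) * ((1 : Matrix c c ℂ) ⊗ₖ Q) := by
          simp only [Matrix.conjTranspose_mul, Matrix.mul_assoc]
      _ = _ := by
          rw [hM, Matrix.mul_one, Matrix.conjTranspose_kronecker, ← Matrix.mul_kronecker_mul,
            Matrix.conjTranspose_one, Matrix.mul_one]
  · intro X
    rw [← hL, hA]
  · intro X
    rw [← hL, hB]
  · rw [spectralSum_mul_comm Real.negMulLog_zero, ← hQ]

/-- The joint output of reference and masker is separable if the blocks of all outputs commute. -/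
lemma IsMaskingTensor.log_card_add_left_le_of_slicesCommute [Nonempty c] {k : Type*} [Fintype k]
    [DecidableEq k] {L : Matrix (a × b) (c × k) ℂ} {κ : Matrix k k ℂ} {ρA : Matrix a a ℂ}
    {ρB : Matrix b b ℂ} (h : IsMaskingTensor L κ ρA ρB)
    (hc : ∀ X Y : Matrix c c ℂ, SlicesCommute (L * (X ⊗ₖ (1 : Matrix k k ℂ)) * Lᴴ)
      (L * (Y ⊗ₖ (1 : Matrix k k ℂ)) * Lᴴ)) :
    Real.log (Fintype.card c) + spectralSum Real.negMulLog ρA ≤ spectralSum Real.negMulLog κ := by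
  have hs (r r' : c) (x y : a) : slice (jointOutput L * (jointOutput L)ᴴ) (r, x) (r', y) =
      slice (L * (Matrix.single r r' (1 : ℂ) ⊗ₖ (1 : Matrix k k ℂ)) * Lᴴ) x y := by
    ext u v
    simp only [slice, Matrix.of_apply, mul_single_kronecker_one_mul_apply]
    simp [jointOutput, Matrix.mul_apply]
  have hcomm : SlicesCommute (jointOutput L * (jointOutput L)ᴴ)
      (jointOutput L * (jointOutput L)ᴴ) := by
    rintro ⟨r, x⟩ ⟨r', y⟩ ⟨q, z⟩ ⟨q', w⟩
    rw [hs, hs]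
    exact hc _ _ x y z w
  obtain ⟨E, R, hE, -, hR, hP⟩ :=
    exists_blockDiagonal (Matrix.posSemidef_self_mul_conjTranspose (jointOutput L)) hcomm
  -- The joint output is block diagonal in the basis `E` of the second system. Factoring each
  -- positive block writes it through product columns whose second factors are columns of `E`.
  choose m Q hQ using fun j => exists_mul_conjTranspose (hR j)
  refine h.log_card_add_left_le (l := Σ j, Fin (m j))
    (X := Matrix.of fun i p => Q p.1 i p.2) (Y := Matrix.of fun u p => E u p.1) (fun p => ?_) ?_
  · have := congrFun (congrFun hE p.1) p.1
    rw [Matrix.one_apply_eq] at this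
    exact this
  · ext ⟨i, u⟩ ⟨j, v⟩
    have h1 := congrFun (congrFun (hP i j) u) v
    change (jointOutput L * (jointOutput L)ᴴ) (i, u) (j, v) = _ at h1
    rw [h1, Matrix.mul_apply, Matrix.mul_apply, Fintype.sum_sigma]
    refine Finset.sum_congr rfl fun t _ => ?_
    rw [Matrix.mul_diagonal, hQ t, Matrix.mul_apply, Finset.mul_sum, Finset.sum_mul]
    refine Finset.sum_congr rfl fun q _ => ?_
    simp [productColumns]
    ring

/-- Tensoring with a unit vector is an isometry. Hence all pure outputs have the entropy of the safe
state. -/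
lemma spectralSum_ketbra_kronecker {g : ℝ → ℝ} (hg : g 0 = 0) {ψ : EuclideanSpace ℂ c}
    (hψ : ‖ψ‖ = 1) (ω : Matrix s s ℂ) : spectralSum g (ketbra ψ ⊗ₖ ω) = spectralSum g ω := by
  let W : Matrix (c × s) s ℂ := Matrix.of fun i y => if i.2 = y then ψ i.1 else 0
  have hW : Wᴴ * W = 1 := by
    have h1 := trace_ketbra ψ
    rw [hψ] at h1
    simp only [Matrix.trace, ketbra, Matrix.diag_apply, Matrix.of_apply] at h1
    ext x y
    rcases eq_or_ne x y with rfl | hxy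
    · simpa [W, Matrix.mul_apply, Fintype.sum_prod_type, mul_comm] using h1
    · simp [W, Matrix.mul_apply, Fintype.sum_prod_type, hxy, hxy.symm]
  have : ketbra ψ ⊗ₖ ω = W * ω * Wᴴ := by
    ext ⟨i, x⟩ ⟨j, y⟩
    simp [W, Matrix.mul_apply, ketbra, apply_ite (starRingEnd ℂ)]
    ring
  rw [this, spectralSum_conj hg hW]

end Maskers

/-! ### The equality case for separable states -/

section Separable

variable {a b c s k : Type*} [Fintype a] [DecidableEq a] [Fintype b] [DecidableEq b]
  [Fintype c] [DecidableEq c] [Fintype s] [DecidableEq s] [Fintype k] [DecidableEq k]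

lemma IsState.exists_sum_ketbra {ρ : Matrix c c ℂ} (h : IsState ρ) :
    ∃ (p : c → ℝ) (v : c → EuclideanSpace ℂ c), (∀ i, 0 ≤ p i) ∧ ∑ i, p i = 1 ∧
      (∀ i, ‖v i‖ = 1) ∧ ρ = ∑ i, (p i : ℂ) • ketbra (v i) := by
  obtain ⟨U, hU, -, hρ⟩ := exists_unitary_diagonal h.posSemidef.isHermitian
  refine ⟨h.posSemidef.isHermitian.eigenvalues, fun i => WithLp.toLp 2 fun x => U x i,
    fun i => (h.eigenvalues_mem i).1, h.sum_eigenvalues, fun i => ?_, ?_⟩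
  · have h1 := trace_ketbra (WithLp.toLp 2 fun x => U x i)
    have h2 := congrFun (congrFun hU i) i
    simp only [Matrix.mul_apply, Matrix.conjTranspose_apply, Matrix.one_apply_eq] at h2
    have h3 : (ketbra (WithLp.toLp 2 fun x => U x i)).trace = 1 := by
      rw [← h2]
      exact Finset.sum_congr rfl fun x _ => mul_comm _ _
    rw [h3] at h1
    have h4 : ‖WithLp.toLp 2 fun x => U x i‖ ^ 2 = 1 := by exact_mod_cast h1.symm
    exact (pow_eq_one_iff_of_nonneg (norm_nonneg _) two_ne_zero).1 h4
  · conv_lhs => rw [hρ]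
    ext x y
    rw [Matrix.mul_apply, Matrix.sum_apply]
    refine Finset.sum_congr rfl fun i _ => ?_
    simp [ketbra]
    ring

lemma IsSeparable.exists_sum_ketbra {X : Matrix (a × b) (a × b) ℂ} (h : IsSeparable X) :
    ∃ (r : ℕ) (p : Fin r × a × b → ℝ) (α : Fin r × a × b → EuclideanSpace ℂ a)
      (β : Fin r × a × b → EuclideanSpace ℂ b), (∀ i, 0 ≤ p i) ∧ ∑ i, p i = 1 ∧
      (∀ i, ‖α i‖ = 1) ∧ (∀ i, ‖β i‖ = 1) ∧
      X = ∑ i, (p i : ℂ) • (ketbra (α i) ⊗ₖ ketbra (β i)) := by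
  obtain ⟨r, p, σ, τ, hp, hp1, hσ, hτ, rfl⟩ := h
  choose q v hq hq1 hv hσv using fun i => (hσ i).exists_sum_ketbra
  choose q' v' hq' hq1' hv' hτv using fun i => (hτ i).exists_sum_ketbra
  refine ⟨r, fun i => p i.1 * (q i.1 i.2.1 * q' i.1 i.2.2), fun i => v i.1 i.2.1,
    fun i => v' i.1 i.2.2, fun i => mul_nonneg (hp _) (mul_nonneg (hq _ _) (hq' _ _)), ?_,
    fun i => hv _ _, fun i => hv' _ _, ?_⟩
  · simp only [Fintype.sum_prod_type, ← Finset.mul_sum, hq1', hq1, mul_one, hp1]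
  · ext x y
    simp only [Fintype.sum_prod_type, Matrix.sum_apply, Matrix.smul_apply, smul_eq_mul,
      Matrix.kroneckerMap_apply]
    refine Finset.sum_congr rfl fun i _ => ?_
    rw [hσv i, hτv i]
    rw [Matrix.sum_apply, Matrix.sum_apply, Finset.sum_mul_sum, Finset.mul_sum]
    refine Finset.sum_congr rfl fun j _ => ?_
    rw [Finset.mul_sum]
    refine Finset.sum_congr rfl fun l _ => ?_
    simp only [Matrix.smul_apply, smul_eq_mul]
    push_cast
    ring

lemma trace_mul_self_of_isHermitian {G : Matrix k k ℂ} (h : G.IsHermitian) :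
    (G * G).trace.re = ∑ i, ∑ j, ‖G i j‖ ^ 2 := by
  simp only [Matrix.trace, Matrix.diag_apply, Matrix.mul_apply, Complex.re_sum]
  refine Finset.sum_congr rfl fun i _ => Finset.sum_congr rfl fun j _ => ?_
  rw [← h.apply j i, RCLike.star_def, Complex.mul_conj']
  exact_mod_cast rfl

lemma trace_mul_self_gram (Z : Matrix c k ℂ) :
    (Z * Zᴴ * (Z * Zᴴ)).trace.re = ∑ i, ∑ j, ‖(Zᴴ * Z) i j‖ ^ 2 := by
  rw [← trace_mul_self_of_isHermitian (Matrix.isHermitian_conjTranspose_mul_self Z)]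
  congr 1
  rw [Matrix.mul_assoc, Matrix.trace_mul_comm]
  simp only [Matrix.mul_assoc]

/-- The weights all go into the first factor, so the second keeps unit columns when the `β i` are
unit vectors. -/
lemma sum_smul_ketbra_kronecker_eq {p : k → ℝ} (hp : ∀ i, 0 ≤ p i)
    (α : k → EuclideanSpace ℂ a) (β : k → EuclideanSpace ℂ b) :
    ∑ i, (p i : ℂ) • (ketbra (α i) ⊗ₖ ketbra (β i)) =
      productColumns (Matrix.of fun x i => (Real.sqrt (p i) : ℂ) * α i x)
          (Matrix.of fun u i => β i u) *
        (productColumns (Matrix.of fun x i => (Real.sqrt (p i) : ℂ) * α i x)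
          (Matrix.of fun u i => β i u))ᴴ := by
  ext x y
  simp only [Matrix.sum_apply, Matrix.mul_apply]
  refine Finset.sum_congr rfl fun i _ => ?_
  have : (p i : ℂ) = (Real.sqrt (p i) : ℂ) * (Real.sqrt (p i) : ℂ) := by
    rw [← Complex.ofReal_mul, Real.mul_self_sqrt (hp i)]
  rw [Matrix.smul_apply, this]
  simp [productColumns, ketbra]
  ring

/-- A separable state that is no more disordered than its first marginal is perfectly correlated. -/
lemma inner_eq_zero_or_norm_inner_eq_one {p : k → ℝ} (hp : ∀ i, 0 ≤ p i) (hp1 : ∑ i, p i = 1)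
    {α : k → EuclideanSpace ℂ a} {β : k → EuclideanSpace ℂ b} (hα : ∀ i, ‖α i‖ = 1)
    (hβ : ∀ i, ‖β i‖ = 1) {P : Matrix (a × b) (a × b) ℂ}
    (hP : P = ∑ i, (p i : ℂ) • (ketbra (α i) ⊗ₖ ketbra (β i)))
    (hle : spectralSum Real.negMulLog P ≤ spectralSum Real.negMulLog (traceB P)) {i j : k}
    (hi : p i ≠ 0) (hj : p j ≠ 0) : inner ℂ (α i) (α j) = 0 ∨ ‖inner ℂ (β i) (β j)‖ = 1 := by
  set X : Matrix a k ℂ := Matrix.of fun x i => (Real.sqrt (p i) : ℂ) * α i x with hX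
  set Y : Matrix b k ℂ := Matrix.of fun u i => β i u with hY
  have hYG (i j : k) : (Yᴴ * Y) i j = inner ℂ (β i) (β j) := by
    rw [Matrix.mul_apply, PiLp.inner_apply]
    refine Finset.sum_congr rfl fun u _ => ?_
    simp [hY, mul_comm]
  have hXG (i j : k) : (Xᴴ * X) i j =
      (Real.sqrt (p i) : ℂ) * (Real.sqrt (p j) : ℂ) * inner ℂ (α i) (α j) := by
    rw [Matrix.mul_apply, PiLp.inner_apply, Finset.mul_sum]
    refine Finset.sum_congr rfl fun u _ => ?_
    simp [hX]
    ring
  have hY1 (i : k) : (Yᴴ * Y) i i = 1 := by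
    rw [hYG, inner_self_eq_norm_sq_to_K, hβ]
    simp
  have hPZ : P = productColumns X Y * (productColumns X Y)ᴴ := by
    rw [hP, sum_smul_ketbra_kronecker_eq hp]
  have hA : traceB P = X * Xᴴ := by rw [hPZ, traceB_productColumns X hY1]
  have htr : (X * Xᴴ).trace = 1 := by
    rw [Matrix.trace_mul_comm, Matrix.trace]
    simp only [Matrix.diag_apply, hXG]
    have : ∀ i, (Real.sqrt (p i) : ℂ) * (Real.sqrt (p i) : ℂ) * inner ℂ (α i) (α i) = (p i : ℂ) := by
      intro i
      rw [inner_self_eq_norm_sq_to_K, hα, ← Complex.ofReal_mul, Real.mul_self_sqrt (hp i)]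
      simp
    simp only [this]
    exact_mod_cast hp1
  -- With the quadratic correction the entropy hypothesis forces the purity of `P` to be at least
  -- that of its marginal. Schur multiplication by entries of modulus at most 1 only shrinks each
  -- Gram entry, so every entry keeps its modulus.
  have h1 := spectralSum_traceB_le concaveOn_negMulLog_add_sq (by simp) X hY1 htr
  rw [spectralSum_negMulLog_add_sq (Matrix.isHermitian_mul_conjTranspose_self X),
    spectralSum_negMulLog_add_sq (Matrix.isHermitian_mul_conjTranspose_self _),
    trace_mul_self_gram, trace_mul_self_gram, ← hPZ, ← hA, gram_productColumns] at h1
  have hbound (i j : k) : ‖(Yᴴ * Y) i j‖ ≤ 1 := by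
    rw [hYG]
    simpa [hβ] using norm_inner_le_norm (𝕜 := ℂ) (β i) (β j)
  have hterm (i j : k) : 0 ≤ ‖(Xᴴ * X) i j‖ ^ 2 - ‖((Xᴴ * X).hadamard (Yᴴ * Y)) i j‖ ^ 2 := by
    rw [Matrix.hadamard_apply, norm_mul, mul_pow]
    have := pow_le_one₀ (n := 2) (norm_nonneg _) (hbound i j)
    nlinarith [sq_nonneg ‖(Xᴴ * X) i j‖]
  have hsum : ∑ i, ∑ j, (‖(Xᴴ * X) i j‖ ^ 2 - ‖((Xᴴ * X).hadamard (Yᴴ * Y)) i j‖ ^ 2) = 0 := by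
    refine le_antisymm ?_ (Finset.sum_nonneg fun i _ => Finset.sum_nonneg fun j _ => hterm i j)
    simp only [Finset.sum_sub_distrib]
    linarith
  have hz := (Finset.sum_eq_zero_iff_of_nonneg fun j _ => hterm i j).1
    ((Finset.sum_eq_zero_iff_of_nonneg fun i _ => Finset.sum_nonneg fun j _ => hterm i j).1 hsum i
      (Finset.mem_univ i)) j (Finset.mem_univ j)
  rw [Matrix.hadamard_apply, norm_mul, mul_pow, ← mul_one_sub] at hz
  have hsq {q : ℝ} (hq : 0 ≤ q) (hq0 : q ≠ 0) : (Real.sqrt q : ℂ) ≠ 0 :=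
    Complex.ofReal_ne_zero.2 (Real.sqrt_ne_zero'.2 (hq.lt_of_ne' hq0))
  rcases mul_eq_zero.1 hz with h | h
  · left
    have h2 := norm_eq_zero.1 (pow_eq_zero_iff two_ne_zero |>.1 h)
    rw [hXG] at h2
    exact (mul_eq_zero.1 h2).resolve_left
      (mul_ne_zero (hsq (hp i) hi) (hsq (hp j) hj))
  · right
    rw [hYG] at h
    exact (pow_eq_one_iff_of_nonneg (norm_nonneg _) two_ne_zero).1 (by linarith)

/-- A separable state that is no more disordered than either marginal has commuting blocks with
respect to both systems. -/
lemma IsSeparable.slicesCommute {P : Matrix (a × b) (a × b) ℂ} (h : IsSeparable P)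
    (hA : spectralSum Real.negMulLog P ≤ spectralSum Real.negMulLog (traceB P))
    (hB : spectralSum Real.negMulLog P ≤ spectralSum Real.negMulLog (traceA P)) :
    SlicesCommute P P ∧ SlicesCommute (swapSystems P) (swapSystems P) := by
  obtain ⟨r, p, α, β, hp, hp1, hα, hβ, hP⟩ := h.exists_sum_ketbra
  have hP' : swapSystems P = ∑ i, (p i : ℂ) • (ketbra (β i) ⊗ₖ ketbra (α i)) := by
    rw [hP, swapSystems_sum_kronecker]
  have hsw : spectralSum Real.negMulLog (swapSystems P) = spectralSum Real.negMulLog P :=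
    spectralSum_submatrix_equiv _ (Equiv.prodComm b a) P
  have d1 {i j} := inner_eq_zero_or_norm_inner_eq_one hp hp1 hα hβ hP hA (i := i) (j := j)
  have d2 {i j} := inner_eq_zero_or_norm_inner_eq_one hp hp1 hβ hα hP' (by rw [hsw]; exact hB)
    (i := i) (j := j)
  have d3 {i j} (hi : p i ≠ 0) (hj : p j ≠ 0) :
      Commute (ketbra (α i)) (ketbra (α j)) ∧ Commute (ketbra (β i)) (ketbra (β j)) := by
    -- The mixed cases are contradictory, so in each pair of terms both factors are orthogonal or
    -- both are parallel; either way the projections commute.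
    rcases d1 hi hj with h1 | h1 <;> rcases d2 hi hj with h2 | h2
    · exact ⟨commute_ketbra_of_inner_eq_zero h1, commute_ketbra_of_inner_eq_zero h2⟩
    · simp [h1] at h2
    · simp [h2] at h1
    · exact ⟨commute_ketbra_of_norm_inner_eq_one (hα i) (hα j) h2,
        commute_ketbra_of_norm_inner_eq_one (hβ i) (hβ j) h1⟩
  refine ⟨?_, ?_⟩
  · rw [hP]
    exact slicesCommute_sum_kronecker fun i j hi hj =>
      (d3 (by exact_mod_cast hi) (by exact_mod_cast hj)).2
  · rw [hP']
    exact slicesCommute_sum_kronecker fun i j hi hj =>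
      (d3 (by exact_mod_cast hi) (by exact_mod_cast hj)).1

end Separable

end Masking

/-! ### Assembly of the bounds and the impossibility results -/

theorem theorem1 (d : ℕ) (hd : 1 ≤ d) {a b s : Type*} [Fintype a] [DecidableEq a]
    [Fintype b] [DecidableEq b] [Fintype s] [DecidableEq s] :
    -- entropy bounds for the safe state of a universal masker
    (∀ (Φ : Matrix (Fin d) (Fin d) ℂ →ₗ[ℂ] Matrix (a × b) (a × b) ℂ) (ω : Matrix s s ℂ)
        (_ : Masking.IsUniversalMasker Φ) (hω : Masking.IsSafeState Φ ω),
      Real.logb 2 d ≤ Masking.vonNeumannEntropy hω.isHermitian ∧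
      (2 ≤ d → (∀ ρ, Masking.IsState ρ → Masking.IsSeparable (Φ ρ)) →
        Real.logb 2 d < Masking.vonNeumannEntropy hω.isHermitian) ∧
      ((∀ ρ, Masking.IsState ρ → Masking.IsQuantumClassical (Φ ρ)) →
        2 * Real.logb 2 d ≤ Masking.vonNeumannEntropy hω.isHermitian)) ∧
    -- no universal masker has only classically correlated outputs
    (2 ≤ d → ¬ ∃ Φ : Matrix (Fin d) (Fin d) ℂ →ₗ[ℂ] Matrix (a × b) (a × b) ℂ,
      Masking.IsUniversalMasker Φ ∧
        ∀ ρ, Masking.IsState ρ → Masking.IsClassicallyCorrelated (Φ ρ)) ∧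
    -- no-masking theorem: no isometry masks all pure states
    (2 ≤ d → ¬ ∃ V : Matrix (a × b) (Fin d) ℂ, Vᴴ * V = 1 ∧
      Masking.Masks (Masking.conj V) (Masking.pureStates (Fin d))) := by
  open Masking in
  have hne : Nonempty (Fin d) := ⟨⟨0, hd⟩⟩
  have hlog2 : 0 < Real.log 2 := Real.log_pos one_lt_two
  have hpure {ρ : Matrix (Fin d) (Fin d) ℂ} (hρ : ρ ∈ pureStates (Fin d)) : IsState ρ := by
    obtain ⟨ψ, hψ, rfl⟩ := hρ
    exact isState_ketbra hψ
  refine ⟨fun Φ ω hΦ hω => ?_, fun h2 => ?_, fun h2 => ?_⟩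
  · obtain ⟨ρA, ρB, hA, hHide, -⟩ := hΦ.exists_hiding
    obtain ⟨M, hM, hMΦ⟩ := hω.dilation
    have hΦM (X : Matrix (Fin d) (Fin d) ℂ) : Φ X = M * (X ⊗ₖ ω) * Mᴴ := by
      have hX : X ∈ Submodule.span ℂ (pureStates (Fin d)) := by rw [span_pureStates]; trivial
      induction hX using Submodule.span_induction with
      | mem σ hσ => exact hMΦ σ (hpure hσ)
      | zero => simp
      | add X Y _ _ hX hY =>
        rw [map_add, hX, hY, Matrix.add_kronecker, Matrix.mul_add, Matrix.add_mul]
      | smul t X _ hX =>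
        rw [map_smul, hX, Matrix.smul_kronecker, Matrix.mul_smul, Matrix.smul_mul]
    obtain ⟨m, L, κ, hL, hML, hκ⟩ := exists_isMaskingTensor hM hω.isState
      (fun X => by rw [← hΦM, hA]) (fun X => by rw [← hΦM, hHide.marginal])
    have e1 := hL.log_card_le
    have eA := hL.log_card_le_left
    have eB := hL.swap.log_card_le_left
    rw [Fintype.card_fin, hκ] at e1
    rw [Fintype.card_fin] at eA eB
    rw [vonNeumannEntropy_eq_spectralSum, Real.logb]
    refine ⟨by gcongr, fun h2 hsep => ?_, fun hQC => ?_⟩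
    · have : Nontrivial (Fin d) := Fin.nontrivial_iff_two_le.2 h2
      by_contra hlt
      have hle : spectralSum Real.negMulLog ω ≤ Real.log d := by
        -- If strictness fails, every pure output has entropy `S(ω) ≤ log d`, which `eA` and `eB`
        -- bound by the entropy of either marginal.
        rwa [not_lt, div_le_div_iff_of_pos_right hlog2] at hlt
      refine hΦ.not_pure_slicesCommute fun ρ hρ => ?_
      have hsp : spectralSum Real.negMulLog (Φ ρ) = spectralSum Real.negMulLog ω := by
        obtain ⟨ψ, hψ, rfl⟩ := hρ
        rw [hΦM, spectralSum_conj Real.negMulLog_zero hM,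
          spectralSum_ketbra_kronecker Real.negMulLog_zero hψ]
      refine (hsep ρ (hpure hρ)).slicesCommute ?_ ?_
      · rw [hsp, hA, (hpure hρ).trace_eq_one, one_smul]
        exact hle.trans eA
      · rw [hsp, hHide.marginal, (hpure hρ).trace_eq_one, one_smul]
        exact hle.trans eB
    · have hall := hHide.slicesCommute_all fun ρ hρ => (hQC ρ hρ).slicesCommute
      have e3 := hL.log_card_add_left_le_of_slicesCommute fun X Y => by
        rw [← hML, ← hML, ← hΦM, ← hΦM]
        exact hall X Y
      rw [Fintype.card_fin, hκ] at e3
      rw [← mul_div_assoc]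
      gcongr
      linarith
  · have : Nontrivial (Fin d) := Fin.nontrivial_iff_two_le.2 h2
    rintro ⟨Φ, hΦ, hCC⟩
    exact hΦ.not_pure_slicesCommute fun ρ hρ => (hCC ρ (hpure hρ)).slicesCommute
  · rintro ⟨V, hV, hmask⟩
    obtain ⟨ρA, hA⟩ := hmask.marginalA
    obtain ⟨ρB, hB⟩ := hmask.marginalB
    -- An isometry is a masking operator with a one-dimensional ancilla, whose only state has zero
    -- entropy. Only the two marginal conditions are needed.
    have hone : IsState (1 : Matrix (Fin 1) (Fin 1) ℂ) := ⟨Matrix.PosSemidef.one, by simp⟩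
    have hVX (X : Matrix (Fin d) (Fin d) ℂ) :
        V.submatrix id (Prod.fst : Fin d × Fin 1 → Fin d) * (X ⊗ₖ (1 : Matrix (Fin 1) (Fin 1) ℂ)) *
          (V.submatrix id (Prod.fst : Fin d × Fin 1 → Fin d))ᴴ = conj V X := by
      ext i j
      simp [conj, Matrix.mul_apply, Fintype.sum_prod_type]
    obtain ⟨m, L, κ, hL, -, hκ⟩ := exists_isMaskingTensor (ρA := ρA) (ρB := ρB)
      (M := V.submatrix id (Prod.fst : Fin d × Fin 1 → Fin d)) (by
        rw [Matrix.conjTranspose_submatrix, ← Matrix.submatrix_mul _ _ _ _ _ Function.bijective_id,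
          hV]
        ext ⟨i, i'⟩ ⟨j, j'⟩
        simp [Matrix.one_apply, Subsingleton.elim i' j']) hone
      (fun X => by rw [hVX]; exact traceB_eq_trace_smul hA X)
      (fun X => by rw [hVX]; exact traceA_eq_trace_smul hB X)
    have e1 := hL.log_card_le
    rw [Fintype.card_fin, hκ, ← Matrix.diagonal_one, spectralSum_diagonal] at e1
    have : 0 < Real.log d := Real.log_pos (by exact_mod_cast h2)
    simp at e1
    linarith
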